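/- **Theorem 1.1.** All matroids are on finite ground sets. To every loopless matroid $M$ one associates its Kazhdan–Lusztig polynomial $P_M(t)\in\mathbb{Z}[t]$; this is the unique family of polynomials such that 1. if $\operatorname{rk}(M)=0$, then $P_M(t)=1$; 2. if $\operatorname{rk}(M)>0$, then $\deg P_M(t)<\tfrac12\operatorname{rk}(M)$; 3. for every loopless matroid $M$, the polynomial $Z_M(t)=\sum_{F} t^{\operatorname{rk}(F)}P_{M/F}(t)$, where the sum is over all flats $F$ of $M$, has degree $\operatorname{rk}(M)$ and is palindromic, i.e. $Z_M(t)=t^{\operatorname{rk}(M)}Z_M(t^{-1})$. The polynomial $Z_M(t)$ is the $Z$-polynomial of $M$. A matroid $M'$ is a parallel extension of a matroid $M$ if some element $e$ of $M'$ belongs to a circuit of size $2$ of $M'$ and $M'\setminus e=M$; it is a series extension of $M$ if some element $e$ of $M'$ belongs to a cocircuit of size $2$ of $M'$ and $M'/e=M$. A matroid is series-parallel if it is obtained from a single loop or a single coloop by a finite (possibly empty) sequence of series and parallel extensions. A matroid is quasi series-parallel if all its connected components are series-parallel. A matroid is simple if it is loopless and has no circuit of size $2$. For an integer $m\ge 0$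 and an integer $r$, let $\mathcal{A}(m,r)$ be the set of all quasi series-parallel matroids on the ground set $[m]=\{1,\dots,m\}$ of rank $r$ (the empty set if $r<0$), and let $\mathcal{S}(m,r)\subseteq\mathcal{A}(m,r)$ be the subset of simple ones. For $n\ge 1$ let $\mathsf{K}_n$ be the braid matroid, i.e. the cycle matroid of the complete graph on $n$ vertices. Then for every $n\ge 1$ and every $i\ge 0$, $$[t^i]\,P_{\mathsf{K}_n}(t)=|\mathcal{S}(n-1,\,n-1-i)|,\qquad [t^i]\,Z_{\mathsf{K}_n}(t)=|\mathcal{A}(n-1,\,n-1-i)|,$$ where $[t^i]f(t)$ denotes the coefficient of $t^i$ in $f(t)$. -/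

import Mathlib

noncomputable section

namespace BraidKL

open Polynomial
open scoped Matroid

variable {α : Type*}

/-! ### Rank -/

/-- The rank of a matroid as a natural number (it is only used for finite matroids). -/
def rank (M : Matroid α) : ℕ := M.eRank.toNat

/-- The rank of a set in a matroid as a natural number (it is only used for finite matroids). -/
def rk (M : Matroid α) (X : Set α) : ℕ := (M.eRk X).toNat

/-! ### Kazhdan–Lusztig polynomials and `Z`-polynomials of matroids -/

/-- Loopless matroids (with finite ground set) whose elements are taken from `α`. -/
def LooplessMatroid (α : Type*) : Type _ := {M : Matroid α // M.Finite ∧ M.Loopless}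

theorem loopless_contract {M : Matroid α} {F : Set α} (hF : M.IsFlat F) : (M ／ F).Loopless :=
  ⟨by rw [Matroid.contract_loops_eq, hF.closure, Set.sdiff_self]⟩

/-- The contraction `M / F` of a loopless matroid at a flat is again loopless. -/
def LooplessMatroid.contract (M : LooplessMatroid α) (F : {F : Set α // M.1.IsFlat F}) :
    LooplessMatroid α :=
  ⟨M.1 ／ F.1, haveI := M.2.1; inferInstance, loopless_contract F.2⟩

/-- `∑_F t^{rk F} P_{M/F}(t)`, the sum being over the (finitely many) flats `F` of `M`. -/
def zSum (P : LooplessMatroid α → ℤ[X]) (M : LooplessMatroid α) : ℤ[X] :=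
  ∑ᶠ F : {F : Set α // M.1.IsFlat F}, X ^ rk M.1 F.1 * P (M.contract F)

/-- `f` is palindromic: `f(t) = t ^ d * f(1/t)`, where `d` is the degree of `f`. -/
def Palindromic (f : ℤ[X]) : Prop := f.reverse = f

/-- The three properties that characterize the Kazhdan–Lusztig polynomials of matroids. -/
structure IsKLFamily (P : LooplessMatroid α → ℤ[X]) : Prop where
  rank_zero : ∀ M, rank M.1 = 0 → P M = 1
  degree_lt : ∀ M, 0 < rank M.1 → 2 * (P M).natDegree < rank M.1
  palindromic : ∀ M, Palindromic (zSum P M) ∧ (zSum P M).natDegree = rank M.1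

/-! #### Existence and uniqueness -/

theorem finite_flats {M : Matroid α} (hM : M.Finite) : Finite {F : Set α // M.IsFlat F} :=
  (hM.ground_finite.powerset.subset fun _ hF => Matroid.IsFlat.subset_ground hF).to_subtype

theorem rank_contract {M : Matroid α} (hM : M.Finite) {F : Set α} (hF : M.IsFlat F) :
    rank (M ／ F) + rk M F = rank M := by
  obtain ⟨I, hI⟩ := M.exists_isBasis F hF.subset_ground
  obtain ⟨B, hB, hIB⟩ := hI.indep.exists_isBase_superset
  have h1 := hI.contract_sdiff_isBasis_sdiff hB.isBasis_ground hIB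
  have h2 : (M ／ F).IsBase (B \ I) := by
    rw [← Matroid.isBasis_ground_iff, hI.contract_eq_contract_delete,
      Matroid.isBasis_ground_iff]
    have h3 := h1.isBase_restrict
    rw [Matroid.delete_eq_restrict]
    convert! h3 using 2
    have := hI.subset
    simp only [Matroid.contract_ground]
    rw [Set.sdiff_sdiff, Set.union_sdiff_cancel this]
  rw [rank, rank, rk, ← h2.encard_eq_eRank, ← hB.encard_eq_eRank, ← hI.encard_eq_eRk]
  have hBf : B.Finite := hM.ground_finite.subset hB.subset_ground
  have := Set.ncard_sdiff_add_ncard_of_subset hIB hBf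
  simpa [Set.ncard] using this

theorem rank_contract_pos {M : Matroid α} (hM : M.Finite) {F : Set α} (hF : M.IsFlat F)
    (hne : F ≠ M.E) : 0 < rank (M ／ F) := by
  have := hM
  rcases Nat.eq_zero_or_pos (rank (M ／ F)) with h | h
  · exfalso
    have h0 : (M ／ F).eRank = 0 := by
      rcases (ENat.toNat_eq_zero).1 h with h | h
      · exact h
      · exact absurd h ((Matroid.eRank_ne_top_iff _).2 inferInstance)
    rw [← Matroid.eRk_ground, Matroid.eRk_eq_zero_iff, (loopless_contract hF).loops_eq_empty,
      Matroid.contract_ground, Set.subset_empty_iff, Set.sdiff_eq_empty] at h0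
    exact hne (hF.subset_ground.antisymm h0)
  · exact h

theorem isFlat_empty (M : LooplessMatroid α) : M.1.IsFlat ∅ := by
  have := M.2.2.loops_eq_empty
  rw [← this]
  exact Matroid.isFlat_closure _

theorem contract_empty (M : LooplessMatroid α) : M.contract ⟨∅, isFlat_empty M⟩ = M :=
  Subtype.ext (by simp [LooplessMatroid.contract])

/-- The part of `zSum` that comes from nonempty flats. -/
def zTail (P : LooplessMatroid α → ℤ[X]) (M : LooplessMatroid α) : ℤ[X] :=
  ∑ᶠ F : {F : {F : Set α // M.1.IsFlat F} // F.1.Nonempty},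
    X ^ rk M.1 F.1.1 * P (M.contract F.1)

theorem zSum_eq (P : LooplessMatroid α → ℤ[X]) (M : LooplessMatroid α) :
    zSum P M = P M + zTail P M := by
  classical
  have := finite_flats M.2.1
  have := Fintype.ofFinite {F : Set α // M.1.IsFlat F}
  rw [zSum, zTail, finsum_eq_sum_of_fintype, finsum_eq_sum_of_fintype,
    ← Finset.add_sum_erase _ _ (Finset.mem_univ (⟨∅, isFlat_empty M⟩ : {F // M.1.IsFlat F}))]
  congr 1
  · rw [contract_empty]; simp [rk]
  · refine Finset.sum_subtype _ (fun F => ?_) _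
    rw [Finset.mem_erase, Set.nonempty_iff_ne_empty, Ne, Subtype.ext_iff]
    simp

theorem ncard_contract_lt {M : LooplessMatroid α} {F : {F : Set α // M.1.IsFlat F}}
    (hF : F.1.Nonempty) : (M.contract F).1.E.ncard < M.1.E.ncard := by
  refine Set.ncard_lt_ncard ?_ M.2.1.ground_finite
  obtain ⟨e, he⟩ := hF
  exact ⟨Set.sdiff_subset, fun h => (h (F.2.subset_ground he)).2 he⟩

/-- The unique polynomial of degree `< r/2` whose sum with `Q` is symmetric about `r/2`
(for `Q` of degree at most `r`). -/
def complement (r : ℕ) (Q : ℤ[X]) : ℤ[X] :=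
  ∑ i ∈ Finset.range ((r + 1) / 2), C (Q.coeff (r - i) - Q.coeff i) * X ^ i

theorem coeff_complement (r : ℕ) (Q : ℤ[X]) (i : ℕ) :
    (complement r Q).coeff i = if 2 * i < r then Q.coeff (r - i) - Q.coeff i else 0 := by
  simp only [complement, finsetSum_coeff, coeff_C_mul_X_pow]
  rw [Finset.sum_ite_eq]
  simp only [Finset.mem_range]
  congr 1
  exact propext (by omega)

/-- A recursive construction of the Kazhdan–Lusztig polynomials. -/
def klRec (M : LooplessMatroid α) : ℤ[X] :=
  if rank M.1 = 0 then 1 else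
    complement (rank M.1)
      (∑ᶠ F : {F : {F : Set α // M.1.IsFlat F} // F.1.Nonempty},
        X ^ rk M.1 F.1.1 * klRec (M.contract F.1))
termination_by M.1.E.ncard
decreasing_by exact ncard_contract_lt F.2

theorem klRec_eq (M : LooplessMatroid α) :
    klRec M = if rank M.1 = 0 then 1 else complement (rank M.1) (zTail klRec M) := by
  rw [klRec, zTail]

theorem klRec_degree_lt (M : LooplessMatroid α) (h : 0 < rank M.1) :
    2 * (klRec M).natDegree < rank M.1 := by
  rw [klRec_eq, if_neg h.ne']
  by_contra hcon
  have hc := coeff_complement (rank M.1) (zTail klRec M)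
    (complement (rank M.1) (zTail klRec M)).natDegree
  rw [if_neg hcon] at hc
  have : complement (rank M.1) (zTail klRec M) = 0 := leadingCoeff_eq_zero.1 hc
  rw [this] at hcon
  simp at hcon
  omega

theorem coeff_zTail (M : LooplessMatroid α) (h : 0 < rank M.1) (j : ℕ) (hj : rank M.1 ≤ j) :
    (zTail klRec M).coeff j = if j = rank M.1 then 1 else 0 := by
  classical
  have := finite_flats M.2.1
  have := Fintype.ofFinite {F : {F : Set α // M.1.IsFlat F} // F.1.Nonempty}
  have hE : M.1.E.Nonempty := by
    rw [Set.nonempty_iff_ne_empty]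
    intro hE
    have := M.1.eRank_le_encard_ground
    simp [hE] at this
    simp [rank, this] at h
  rw [zTail, finsum_eq_sum_of_fintype, finsetSum_coeff]
  rw [Finset.sum_eq_single ⟨⟨M.1.E, M.1.ground_isFlat⟩, hE⟩]
  · have h1 := rank_contract M.2.1 M.1.ground_isFlat
    have h2 : rk M.1 M.1.E = rank M.1 := by simp [rk, rank]
    have h3 : klRec (M.contract ⟨M.1.E, M.1.ground_isFlat⟩) = 1 := by
      rw [klRec_eq, if_pos]
      have : rank (M.1 ／ M.1.E) = 0 := by omega
      exact this
    rw [h3, mul_one, h2, coeff_X_pow]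
  · rintro ⟨F, hF⟩ - hne
    have hFE : F.1 ≠ M.1.E := fun h => hne (Subtype.ext (Subtype.ext h))
    have h1 := rank_contract M.2.1 F.2
    have h2 := rank_contract_pos M.2.1 F.2 hFE
    have h3 := klRec_degree_lt (M.contract F) h2
    change 2 * (klRec (M.contract F)).natDegree < rank (M.1 ／ F.1) at h3
    apply coeff_eq_zero_of_natDegree_lt
    refine lt_of_le_of_lt natDegree_mul_le ?_
    rw [natDegree_X_pow]
    change rk M.1 F.1 + (klRec (M.contract F)).natDegree < j
    omega
  · simp

theorem isKLFamily_klRec : IsKLFamily (klRec (α := α)) where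
  rank_zero M h := by rw [klRec_eq, if_pos h]
  degree_lt := klRec_degree_lt
  palindromic M := by
    rcases Nat.eq_zero_or_pos (rank M.1) with h | h
    · have h1 : zSum klRec M = 1 := by
        have hE : M.1.E = ∅ := by
          by_contra hE
          have h2 := rank_contract_pos M.2.1 (isFlat_empty M) (Ne.symm hE)
          rw [Matroid.contract_empty] at h2
          omega
        have : IsEmpty {F : {F : Set α // M.1.IsFlat F} // F.1.Nonempty} := by
          refine ⟨fun F => ?_⟩
          obtain ⟨e, he⟩ := F.2
          have := F.1.2.subset_ground he
          simp [hE] at this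
        rw [zSum_eq, zTail, finsum_of_isEmpty, klRec_eq, if_pos h, add_zero]
      rw [h1, h]
      exact ⟨by rw [Palindromic, ← C_1, reverse_C], natDegree_one⟩
    · have hco : ∀ i, (zSum klRec M).coeff i =
          (if 2 * i < rank M.1 then (zTail klRec M).coeff (rank M.1 - i) - (zTail klRec M).coeff i
            else 0) + (zTail klRec M).coeff i := by
        intro i
        rw [zSum_eq, coeff_add, klRec_eq, if_neg h.ne', coeff_complement]
      have hdeg : (zSum klRec M).natDegree = rank M.1 := by
        refine natDegree_eq_of_le_of_coeff_ne_zero ?_ ?_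
        · rw [natDegree_le_iff_coeff_eq_zero]
          intro N hN
          rw [hco, if_neg (by omega), coeff_zTail M h N hN.le, if_neg (by omega), add_zero]
        · rw [hco, if_neg (by omega), coeff_zTail M h _ le_rfl, if_pos rfl]
          simp
      refine ⟨?_, hdeg⟩
      ext i
      rw [coeff_reverse, hdeg]
      rcases lt_or_ge (rank M.1) i with hi | hi
      · rw [revAt_eq_self_of_lt hi]
      · rw [revAt_le hi, hco, hco]
        rcases lt_trichotomy (2 * i) (rank M.1) with h1 | h1 | h1
        · rw [if_neg (by omega), if_pos h1]; ring
        · rw [show rank M.1 - i = i by omega, if_neg (by omega), if_neg (by omega)]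
        · rw [if_pos (by omega), if_neg (by omega), Nat.sub_sub_self hi]; ring

theorem IsKLFamily.unique {P P' : LooplessMatroid α → ℤ[X]} (hP : IsKLFamily P)
    (hP' : IsKLFamily P') : P = P' := by
  suffices H : ∀ n, ∀ M : LooplessMatroid α, M.1.E.ncard = n → P M = P' M from
    funext fun M => H _ M rfl
  intro n
  induction n using Nat.strong_induction_on with
  | _ n ih =>
  intro M hn
  rcases Nat.eq_zero_or_pos (rank M.1) with h | h
  · rw [hP.rank_zero M h, hP'.rank_zero M h]
  have hT : zTail P M = zTail P' M := by
    refine finsum_congr fun F => ?_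
    rw [ih _ (hn ▸ ncard_contract_lt F.2) _ rfl]
  have key : ∀ {R : LooplessMatroid α → ℤ[X]}, IsKLFamily R → ∀ i, 2 * i < rank M.1 →
      (R M).coeff i = (zTail R M).coeff (rank M.1 - i) - (zTail R M).coeff i := by
    intro R hR i hi
    have h1 := congrArg (fun f => f.coeff i) (hR.palindromic M).1
    simp only [coeff_reverse, (hR.palindromic M).2] at h1
    rw [revAt_le (by omega), zSum_eq, coeff_add, coeff_add] at h1
    have h2 : (R M).coeff (rank M.1 - i) = 0 :=
      coeff_eq_zero_of_natDegree_lt (by have := hR.degree_lt M h; omega)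
    linarith
  ext i
  by_cases hi : 2 * i < rank M.1
  · rw [key hP i hi, key hP' i hi, hT]
  · rw [coeff_eq_zero_of_natDegree_lt (by have := hP.degree_lt M h; omega),
      coeff_eq_zero_of_natDegree_lt (by have := hP'.degree_lt M h; omega)]

/-- There is exactly one family of polynomials with the three characteristic properties. -/
theorem existsUnique_isKLFamily (α : Type*) :
    ∃! P : LooplessMatroid α → ℤ[X], IsKLFamily P :=
  ⟨klRec, isKLFamily_klRec, fun _ h => h.unique isKLFamily_klRec⟩

/-- The Kazhdan–Lusztig polynomial `P_M(t)` of a loopless matroid. -/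
def klPoly (M : LooplessMatroid α) : ℤ[X] := (existsUnique_isKLFamily α).choose M

/-- The `Z`-polynomial `Z_M(t)` of a loopless matroid. -/
def zPoly (M : LooplessMatroid α) : ℤ[X] := zSum klPoly M

/-! ### Braid matroids -/

theorem edgeSet_fromEdgeSet_of_subset {V : Type*} {G : SimpleGraph V} {I : Set (Sym2 V)}
    (h : I ⊆ G.edgeSet) : (SimpleGraph.fromEdgeSet I).edgeSet = I := by
  rw [SimpleGraph.edgeSet_fromEdgeSet]
  ext e
  exact ⟨fun he => he.1, fun he => ⟨he, SimpleGraph.not_isDiag_of_mem_edgeSet G (h he)⟩⟩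

/-- The cycle matroid of a graph: the ground set is the set of edges, and a set of edges is
independent if it contains no cycle. -/
def cycleMatroid {V : Type*} (G : SimpleGraph V) : Matroid (Sym2 V) := IndepMatroid.matroid
  { E := G.edgeSet
    Indep := fun I => I ⊆ G.edgeSet ∧ (SimpleGraph.fromEdgeSet I).IsAcyclic
    indep_empty := by simp
    indep_subset := fun I J hJ hIJ =>
      ⟨hIJ.trans hJ.1, hJ.2.anti (SimpleGraph.fromEdgeSet_mono hIJ)⟩
    indep_aug := by
      intro I B hI hImax hB
      have hle : ∀ {J : Set (Sym2 V)}, J ⊆ G.edgeSet → SimpleGraph.fromEdgeSet J ≤ G :=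
        fun hJ => by
          rw [← SimpleGraph.edgeSet_subset_edgeSet, edgeSet_fromEdgeSet_of_subset hJ]; exact hJ
      have hmax : ∀ {J : Set (Sym2 V)}, J ⊆ G.edgeSet →
          (Maximal (fun I => I ⊆ G.edgeSet ∧ (SimpleGraph.fromEdgeSet I).IsAcyclic) J ↔
          Maximal (fun H => H ≤ G ∧ H.IsAcyclic) (SimpleGraph.fromEdgeSet J)) := by
        intro J hJ
        constructor
        · refine fun h => ⟨⟨hle hJ, h.prop.2⟩, fun H hH hJH => ?_⟩
          have h1 : J ⊆ H.edgeSet := by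
            rw [← edgeSet_fromEdgeSet_of_subset hJ]
            exact SimpleGraph.edgeSet_subset_edgeSet.2 hJH
          have h2 := h.le_of_ge (y := H.edgeSet)
            ⟨SimpleGraph.edgeSet_subset_edgeSet.2 hH.1, by simpa using hH.2⟩ h1
          simpa using SimpleGraph.fromEdgeSet_mono h2
        · refine fun h => ⟨⟨hJ, h.prop.2⟩, fun K hK hJK => ?_⟩
          have h2 := h.le_of_ge (y := SimpleGraph.fromEdgeSet K) ⟨hle hK.1, hK.2⟩
            (SimpleGraph.fromEdgeSet_mono hJK)
          have h3 := SimpleGraph.edgeSet_subset_edgeSet.2 h2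
          rwa [edgeSet_fromEdgeSet_of_subset hK.1, edgeSet_fromEdgeSet_of_subset hJ] at h3
      have hBE : B ⊆ G.edgeSet := hB.prop.1
      rw [hmax hI.1, SimpleGraph.maximal_isAcyclic_iff_reachable_eq (hle hI.1) hI.2] at hImax
      have hBr := (SimpleGraph.maximal_isAcyclic_iff_reachable_eq (hle hBE) hB.prop.2).1
        ((hmax hBE).1 hB)
      by_contra! hcon
      have hadj : ∀ u v, (SimpleGraph.fromEdgeSet B).Adj u v →
          (SimpleGraph.fromEdgeSet I).Reachable u v := by
        intro u v huv
        rw [SimpleGraph.fromEdgeSet_adj] at huv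
        by_cases hI' : s(u, v) ∈ I
        · exact SimpleGraph.Adj.reachable ((SimpleGraph.fromEdgeSet_adj I).2 ⟨hI', huv.2⟩)
        · by_contra hr
          refine hcon s(u, v) ⟨huv.1, hI'⟩ (Set.insert_subset (hBE huv.1) hI.1) ?_
          have := hI.2.sup_edge_of_not_reachable hr
          rwa [SimpleGraph.edge, ← SimpleGraph.fromEdgeSet_union, Set.union_singleton] at this
      have hreach : ∀ u v, (SimpleGraph.fromEdgeSet B).Reachable u v →
          (SimpleGraph.fromEdgeSet I).Reachable u v := by
        rintro u v ⟨p⟩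
        induction p with
        | nil => exact SimpleGraph.Reachable.refl _
        | cons h _ ih => exact (hadj _ _ h).trans ih
      refine hImax (funext fun u => funext fun v => propext ⟨fun h => h.mono (hle hI.1), ?_⟩)
      rw [← hBr]
      exact hreach u v
    indep_maximal := by
      intro X hX I hI hIX
      obtain ⟨H, hIH, hH⟩ := SimpleGraph.exists_maximal_isAcyclic_of_le_isAcyclic
        (SimpleGraph.fromEdgeSet_mono hIX) hI.2
      have hHX : H.edgeSet ⊆ X := by
        have := SimpleGraph.edgeSet_subset_edgeSet.2 hH.prop.1
        rwa [edgeSet_fromEdgeSet_of_subset hX] at this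
      refine ⟨H.edgeSet, ?_, ⟨⟨⟨hHX.trans hX, by simpa using hH.prop.2⟩, hHX⟩, ?_⟩⟩
      · rw [← edgeSet_fromEdgeSet_of_subset hI.1]
        exact SimpleGraph.edgeSet_subset_edgeSet.2 hIH
      · intro K hK hHK
        have h2 := hH.le_of_ge (y := SimpleGraph.fromEdgeSet K)
          ⟨SimpleGraph.fromEdgeSet_mono hK.2, hK.1.2⟩
          (by simpa using SimpleGraph.fromEdgeSet_mono hHK)
        have h3 := SimpleGraph.edgeSet_subset_edgeSet.2 h2
        rwa [edgeSet_fromEdgeSet_of_subset hK.1.1] at h3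
    subset_ground := fun I hI => hI.1 }

theorem finite_cycleMatroid {V : Type*} [Finite V] (G : SimpleGraph V) :
    (cycleMatroid G).Finite := ⟨Set.toFinite _⟩

theorem loopless_cycleMatroid {V : Type*} (G : SimpleGraph V) : (cycleMatroid G).Loopless := by
  rw [Matroid.loopless_iff_forall_isNonloop]
  intro e he
  rw [← Matroid.indep_singleton]
  refine ⟨Set.singleton_subset_iff.2 he, ?_⟩
  induction e with
  | _ u v =>
  have := SimpleGraph.isAcyclic_sup_fromEdgeSet_iff (G := (⊥ : SimpleGraph V)) (u := u) (v := v)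
  rw [bot_sup_eq] at this
  refine this.2 ⟨SimpleGraph.isAcyclic_bot, fun h => Or.inl ?_⟩
  simpa using h

/-- The braid matroid `K_n`: the cycle matroid of the complete graph on `n` vertices. -/
def braidMatroid (n : ℕ) : LooplessMatroid (Sym2 (Fin n)) :=
  ⟨cycleMatroid (⊤ : SimpleGraph (Fin n)), finite_cycleMatroid _, loopless_cycleMatroid _⟩

/-! ### Quasi series-parallel matroids -/

/-- Series-parallel matroids: those obtained from a single loop or a single coloop by a finite
sequence of parallel extensions and series extensions. -/
inductive IsSeriesParallel : Matroid α → Prop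
  | loop (e : α) : IsSeriesParallel (Matroid.loopyOn {e})
  | coloop (e : α) : IsSeriesParallel (Matroid.freeOn {e})
  | parallel (M : Matroid α) (e f : α) (hne : e ≠ f) (hM : M.IsCircuit {e, f})
      (h : IsSeriesParallel (M ＼ {e})) : IsSeriesParallel M
  | series (M : Matroid α) (e f : α) (hne : e ≠ f) (hM : M.IsCocircuit {e, f})
      (h : IsSeriesParallel (M ／ {e})) : IsSeriesParallel M

/-- A separator of a matroid: a set of elements such that no circuit has elements both inside
and outside of it. -/
def IsSeparator (M : Matroid α) (S : Set α) : Prop :=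
  S ⊆ M.E ∧ ∀ C, M.IsCircuit C → C ⊆ S ∨ Disjoint C S

/-- The connected components of a matroid are its minimal nonempty separators. -/
def IsComponent (M : Matroid α) (S : Set α) : Prop :=
  Minimal (fun S => S.Nonempty ∧ IsSeparator M S) S

/-- A matroid is quasi series-parallel if all its connected components are series-parallel. -/
def IsQuasiSeriesParallel (M : Matroid α) : Prop :=
  ∀ S, IsComponent M S → IsSeriesParallel (M ↾ S)

/-- A matroid is simple if it is loopless and has no circuits of size `2`. -/
def IsSimple (M : Matroid α) : Prop :=
  M.Loopless ∧ ∀ C, M.IsCircuit C → C.encard ≠ 2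

/-- The set of quasi series-parallel matroids on an `n`-element ground set `[n]` of rank `r`. It
is empty if `r` is negative. -/
def quasiSP (n : ℕ) (r : ℤ) : Set (Matroid (Fin n)) :=
  {M | M.E = Set.univ ∧ (rank M : ℤ) = r ∧ IsQuasiSeriesParallel M}

/-- The set of simple quasi series-parallel matroids on `[n]` of rank `r`. -/
def simpleQuasiSP (n : ℕ) (r : ℤ) : Set (Matroid (Fin n)) :=
  {M | M ∈ quasiSP n r ∧ IsSimple M}

end BraidKL

end

/-!
The two sides of the theorem satisfy the same recursion, and the recursion has only one solution.

*Braid matroids.* The flats of `K_n` are the equivalence relations `s` on the vertices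
(`equivFlat_bijective`), and `K_n / F_s` is the braid matroid on the classes of `s`, with parallel
elements added (`contract_equivFlat`). Parallel elements do not affect Kazhdan–Lusztig polynomials
(`klPoly_comap`), so `Z_{K_n}` is the sum of `t ^ (n - k) * P_{K_k}` over all equivalence relations
on `[n]`, where `k` is the number of classes (`zPoly_braidMatroid`).

*Quasi series-parallel matroids.* A matroid on `[n - 1]` determines an equivalence relation on
`[n]`: the class of the additional point consists of the loops, and the other classes are the
parallel classes. The matroid is determined by this relation and by its simplification, which is a
simple matroid on `k - 1` elements, and it is quasi series-parallel if and only if its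
simplification is. This gives the same recursion for the numbers of quasi series-parallel matroids
(`ncard_quasiSP_eq_finsum`).

*Uniqueness.* The class of quasi series-parallel matroids is closed under duality, which matches
palindromicity of `Z` (`ncard_quasiSP_symm`), and a nonempty simple quasi series-parallel matroid of
rank `r` has fewer than `2 r` elements, which matches the degree bound for `P`
(`simpleQuasiSP_eq_empty`). As in the characterization of Kazhdan–Lusztig polynomials, symmetry,
degree bound and recursion determine all coefficients (`coeff_klPoly_braidMatroid`).

The matroid theory rests on a description of quasi series-parallel matroids without connected
components: they are the matroids that can be dismantled by deleting loops and parallel elements and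
contracting coloops and series elements (`isQuasiSeriesParallel_iff`). Invariance under
simplification then amounts to the fact that any parallel element may be removed first
(`IsSPReducible.delete_parallel`).
-/

namespace BraidKL

open Matroid Set

variable {α β : Type*} {M : Matroid α} {S T C I : Set α} {e f a b : α}

/-! ### Separators and components -/

theorem IsSeparator.indep_iff (hS : IsSeparator M S) (hI : I ⊆ M.E) :
    M.Indep I ↔ M.Indep (I ∩ S) ∧ M.Indep (I \ S) := by
  refine ⟨fun h => ⟨h.subset inter_subset_left, h.subset sdiff_subset⟩, fun ⟨h1, h2⟩ => ?_⟩
  rw [indep_iff_forall_subset_not_isCircuit hI]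
  intro C hCI hC
  rcases hS.2 C hC with h | h
  · exact hC.not_indep (h1.subset (subset_inter hCI h))
  · exact hC.not_indep (h2.subset (subset_sdiff.2 ⟨hCI, h⟩))

theorem IsSeparator.union_indep (hS : IsSeparator M S) {J : Set α} (hI : M.Indep I)
    (hIS : I ⊆ S) (hJ : M.Indep J) (hJS : Disjoint J S) : M.Indep (I ∪ J) := by
  rw [hS.indep_iff (union_subset hI.subset_ground hJ.subset_ground)]
  rw [union_inter_distrib_right, inter_eq_left.2 hIS, hJS.inter_eq, union_empty,
    union_sdiff_distrib, sdiff_eq_empty.2 hIS, empty_union, hJS.sdiff_eq_left]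
  exact ⟨hI, hJ⟩

/-- The union of a basis inside a separator and a basis outside of it is a base. -/
theorem IsSeparator.isBase_exchange (hS : IsSeparator M S) {B B' : Set α} (hB : M.IsBase B)
    (hB' : M.IsBase B') : M.IsBase (B ∩ S ∪ B' \ S) := by
  refine Indep.isBase_of_forall_insert (hS.union_indep (hB.indep.subset inter_subset_left)
    inter_subset_right (hB'.indep.subset sdiff_subset) disjoint_sdiff_left) ?_
  rintro x ⟨hxE, hx⟩ hI
  by_cases hxS : x ∈ S
  · have hxB : x ∉ B := fun h => hx (Or.inl ⟨h, hxS⟩)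
    refine hB.insert_dep ⟨hxE, hxB⟩ |>.not_indep ?_
    rw [hS.indep_iff (insert_subset hxE hB.subset_ground)]
    refine ⟨hI.subset ?_, hB.indep.subset ?_⟩ <;> grind
  · have hxB : x ∉ B' := fun h => hx (Or.inr ⟨h, hxS⟩)
    refine hB'.insert_dep ⟨hxE, hxB⟩ |>.not_indep ?_
    rw [hS.indep_iff (insert_subset hxE hB'.subset_ground)]
    refine ⟨hB'.indep.subset ?_, hI.subset ?_⟩ <;> grind

theorem IsSeparator.dual (hS : IsSeparator M S) : IsSeparator M✶ S := by
  refine ⟨hS.1, fun K hK => ?_⟩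
  by_contra! hcon
  obtain ⟨h1, h2⟩ := hcon
  rw [not_disjoint_iff] at h2
  rw [not_subset] at h1
  obtain ⟨x, hxK, hxS⟩ := h1
  obtain ⟨y, hyK, hyS⟩ := h2
  have hKS : M✶.Indep (K ∩ S) := hK.ssubset_indep ⟨inter_subset_left, fun h => hxS (h hxK).2⟩
  have hKS' : M✶.Indep (K \ S) := hK.ssubset_indep ⟨sdiff_subset, fun h => (h hyK).2 hyS⟩
  rw [dual_indep_iff_exists'] at hKS hKS'
  obtain ⟨-, B, hB, hBK⟩ := hKS
  obtain ⟨-, B', hB', hBK'⟩ := hKS'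
  refine hK.not_indep ?_
  rw [dual_indep_iff_exists']
  refine ⟨hK.subset_ground, _, hS.isBase_exchange hB hB', ?_⟩
  rw [disjoint_left] at *
  grind

theorem isSeparator_dual_iff : IsSeparator M✶ S ↔ IsSeparator M S :=
  ⟨fun h => by simpa using h.dual, IsSeparator.dual⟩

theorem isComponent_dual_iff : IsComponent M✶ S ↔ IsComponent M S := by
  simp only [IsComponent, isSeparator_dual_iff]

/-- Contraction and deletion of the complement of a separator agree; this is what makes
restriction to a separator commute with duality. -/
theorem IsSeparator.contract_compl (hS : IsSeparator M S) : M ／ (M.E \ S) = M ↾ S := by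
  obtain ⟨J, hJ⟩ := M.exists_isBasis (M.E \ S)
  refine ext_indep ?_ ?_
  · simp [inter_eq_right.2 hS.1]
  · intro I hI
    simp only [contract_ground, sdiff_sdiff_right_self, inter_eq_right.2 hS.1] at hI
    rw [hJ.contract_indep_iff, restrict_indep_iff]
    have hJS : Disjoint J S := disjoint_of_subset_left hJ.subset disjoint_sdiff_left
    constructor
    · exact fun h => ⟨h.1.subset subset_union_left, hI⟩
    · exact fun h => ⟨hS.union_indep h.1 h.2 hJ.indep hJS,
        disjoint_of_subset_right hI disjoint_sdiff_left⟩

theorem IsSeparator.dual_restrict (hS : IsSeparator M S) : M✶ ↾ S = (M ↾ S)✶ := by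
  rw [← hS.contract_compl, dual_contract, delete_eq_restrict, dual_ground,
    sdiff_sdiff_right_self, inter_eq_right.2 hS.1]

theorem IsComponent.isSeparator (h : IsComponent M S) : IsSeparator M S := h.prop.2

theorem IsComponent.subset_of_isSeparator (h : IsComponent M S) (hne : T.Nonempty)
    (hT : IsSeparator M T) (hTS : T ⊆ S) : S ⊆ T :=
  Minimal.le_of_le h ⟨hne, hT⟩ hTS

theorem isSeparator_singleton (he : M.IsLoop e) : IsSeparator M {e} := by
  refine ⟨singleton_subset_iff.2 he.mem_ground, fun C hC => ?_⟩
  by_cases heC : e ∈ C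
  · exact Or.inl (he.eq_of_isCircuit_mem hC heC).subset
  · exact Or.inr (by simpa using heC)

/-- Every component lies inside or outside of a given separator. -/
theorem IsComponent.subset_or_disjoint (hS : IsComponent M S) (hT : IsSeparator M T) :
    S ⊆ T ∨ Disjoint S T := by
  by_contra! h
  have h1 : (S ∩ T).Nonempty := not_disjoint_iff_nonempty_inter.1 h.2
  have h2 : IsSeparator M (S ∩ T) := by
    refine ⟨inter_subset_left.trans hS.isSeparator.1, fun C hC => ?_⟩
    rcases hS.isSeparator.2 C hC with h3 | h3
    · rcases hT.2 C hC with h4 | h4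
      · exact Or.inl (subset_inter h3 h4)
      · exact Or.inr (disjoint_of_subset_right inter_subset_right h4)
    · exact Or.inr (disjoint_of_subset_right inter_subset_left h3)
  exact h.1 fun x hx => (hS.subset_of_isSeparator h1 h2 inter_subset_left hx).2

theorem isSeparator_delete_of_isSeparator (hS : IsSeparator M S) (D : Set α) :
    IsSeparator (M ＼ D) (S \ D) := by
  refine ⟨sdiff_subset_sdiff_left hS.1, fun C hC => ?_⟩
  rw [delete_isCircuit_iff] at hC
  rcases hS.2 C hC.1 with h | h
  · exact Or.inl (subset_sdiff.2 ⟨h, hC.2⟩)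
  · exact Or.inr (disjoint_of_subset_right sdiff_subset h)

theorem isSeparator_of_delete_loop (he : M.IsLoop e) (hS : IsSeparator (M ＼ {e}) S) :
    IsSeparator M S := by
  have heS : e ∉ S := fun h => (hS.1 h).2 rfl
  refine ⟨hS.1.trans sdiff_subset, fun C hC => ?_⟩
  by_cases heC : e ∈ C
  · rw [he.eq_of_isCircuit_mem hC heC]
    exact Or.inr (by simpa)
  · exact hS.2 C (by simpa [heC] using hC)

theorem isComponent_delete_loop_iff (he : M.IsLoop e) :
    IsComponent (M ＼ {e}) S ↔ IsComponent M S ∧ e ∉ S := by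
  constructor
  · intro h
    have heS : e ∉ S := fun h' => (h.isSeparator.1 h').2 rfl
    refine ⟨⟨⟨h.prop.1, isSeparator_of_delete_loop he h.isSeparator⟩, fun T hT hTS => ?_⟩, heS⟩
    refine h.subset_of_isSeparator hT.1 ?_ hTS
    have := isSeparator_delete_of_isSeparator hT.2 {e}
    rwa [sdiff_singleton_eq_self fun h => heS (hTS h)] at this
  · rintro ⟨h, heS⟩
    have := isSeparator_delete_of_isSeparator h.isSeparator {e}
    rw [sdiff_singleton_eq_self heS] at this
    exact ⟨⟨h.prop.1, this⟩, fun T hT hTS =>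
      h.subset_of_isSeparator hT.1 (isSeparator_of_delete_loop he hT.2) hTS⟩

theorem IsSeparator.mem_iff_of_isCircuit (hS : IsSeparator M S) (h : M.IsCircuit {e, f}) :
    e ∈ S ↔ f ∈ S := by
  rcases hS.2 _ h with h | h
  · simp [h (mem_insert e _), h (mem_insert_of_mem e rfl)]
  · simp only [disjoint_insert_left, disjoint_singleton_left] at h
    simp [h]

/-- In a circuit that contains just one of two parallel elements, it can be replaced by the
other. -/
theorem isCircuit_exchange (h : M.IsCircuit {e, f}) (hC : M.IsCircuit C)
    (heC : e ∈ C) (hfC : f ∉ C) : ∃ C' ⊆ insert f (C \ {e}), f ∈ C' ∧ M.IsCircuit C' := by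
  obtain ⟨C', h1, h2, h3⟩ := h.strong_elimination (f := f) hC (by simp) heC (by simp) hfC
  exact ⟨C', fun x hx => by have := h1 hx; grind, h3, h2⟩

/-- A separator of `M ＼ {e}` becomes a separator of `M` once `e` is put on the side of its parallel
element `f`. -/
theorem isSeparator_of_delete_parallel (hne : e ≠ f) (h : M.IsCircuit {e, f})
    (hST : T \ {e} = S) (hT : e ∈ T ↔ f ∈ T) (hS : IsSeparator (M ＼ {e}) S) :
    IsSeparator M T := by
  have hcirc : ∀ C, e ∉ C → M.IsCircuit C → C ⊆ S ∨ Disjoint C S := fun C heC hC =>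
    hS.2 C (by simpa [heC] using hC)
  have hTE : T ⊆ M.E := by
    intro x hx
    by_cases hxe : x = e
    · exact h.subset_ground (by simp [hxe])
    · exact (hS.1 (hST ▸ ⟨hx, hxe⟩)).1
  refine ⟨hTE, fun C hC => ?_⟩
  by_cases heC : e ∈ C
  · by_cases hfC : f ∈ C
    · have : {e, f} = C := h.eq_of_subset_isCircuit hC (by grind)
      subst this
      by_cases heT : e ∈ T <;> simp [insert_subset_iff] <;> tauto
    obtain ⟨C', h1, h2, h3⟩ := isCircuit_exchange h hC heC hfC
    -- exchanging back shows that `C'` contains all of `C` except `e`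
    obtain ⟨C'', h4, h5, h6⟩ := isCircuit_exchange (pair_comm e f ▸ h) h3 h2
      (fun h => by have := h1 h; grind)
    have h7 : C'' = C := h6.eq_of_subset_isCircuit hC fun x hx => by
      have h8 := h4 hx
      have h9 : x ∈ C' → x ∈ insert f (C \ {e}) := @h1 x
      clear hcirc h1 h4
      grind
    subst h7
    rcases hcirc C' (fun h => by have := h1 h; grind) h3 with h | h
    · left
      have := h h2
      intro x hx
      have := h4 hx
      grind
    · right
      have := disjoint_left.1 h
      rw [disjoint_left]
      intro x hx
      have := h4 hx
      grind
  · rcases hcirc C heC hC with h | h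
    · exact Or.inl (h.trans (hST ▸ sdiff_subset))
    · right
      rw [← hST, disjoint_left] at h
      rw [disjoint_left]
      grind

theorem isComponent_sdiff_of_parallel (hne : e ≠ f) (h : M.IsCircuit {e, f})
    (hS : IsComponent M S) : IsComponent (M ＼ {e}) (S \ {e}) := by
  have hef := hS.isSeparator.mem_iff_of_isCircuit h
  refine ⟨⟨?_, isSeparator_delete_of_isSeparator hS.isSeparator _⟩, ?_⟩
  · obtain ⟨x, hx⟩ := hS.prop.1
    by_cases hxe : x = e
    · exact ⟨f, hef.1 (hxe ▸ hx), hne.symm⟩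
    · exact ⟨x, hx, hxe⟩
  · intro T hT hTS
    have heT : e ∉ T := fun h => (hTS h).2 rfl
    by_cases hfT : f ∈ T
    · have h1 := isSeparator_of_delete_parallel (T := insert e T) hne h
        (by simp [heT]) (by simp [hfT]) hT.2
      have h2 := hS.subset_of_isSeparator (insert_nonempty _ _) h1
        (insert_subset (hef.2 (hTS hfT).1) (hTS.trans sdiff_subset))
      rintro x ⟨hx, hxe⟩
      exact (h2 hx).resolve_left hxe
    · have h1 := isSeparator_of_delete_parallel (T := T) hne h
        (by simp [heT]) (by simp [hfT, heT]) hT.2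
      have h2 := hS.subset_of_isSeparator hT.1 h1 (hTS.trans sdiff_subset)
      exact sdiff_subset.trans h2

theorem exists_isComponent_of_isComponent_delete_parallel (hne : e ≠ f) (h : M.IsCircuit {e, f})
    (hS : IsComponent (M ＼ {e}) S) : ∃ T, IsComponent M T ∧ T \ {e} = S := by
  have heS : e ∉ S := fun h => (hS.isSeparator.1 h).2 rfl
  have key : ∀ T, T \ {e} = S → (e ∈ T ↔ f ∈ T) → IsComponent M T := by
    intro T hST hT
    refine ⟨⟨?_, isSeparator_of_delete_parallel hne h hST hT hS.isSeparator⟩, fun U hU hUT => ?_⟩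
    · obtain ⟨x, hx⟩ := hS.prop.1
      exact ⟨x, (hST ▸ hx).1⟩
    · have hU' := hU.2.mem_iff_of_isCircuit h
      have hne' : (U \ {e}).Nonempty := by
        obtain ⟨x, hx⟩ := hU.1
        by_cases hxe : x = e
        · exact ⟨f, hU'.1 (hxe ▸ hx), hne.symm⟩
        · exact ⟨x, hx, hxe⟩
      have h1 := hS.subset_of_isSeparator hne' (isSeparator_delete_of_isSeparator hU.2 {e})
        (hST ▸ sdiff_subset_sdiff_left hUT)
      intro x hx
      by_cases hxe : x = e
      · subst hxe
        exact hU'.2 (h1 (hST ▸ ⟨hT.1 hx, hne.symm⟩)).1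
      · exact (h1 (hST ▸ ⟨hx, hxe⟩)).1
  by_cases hfS : f ∈ S
  · exact ⟨insert e S, key _ (by simp [heS]) (by simp [hfS]), by simp [heS]⟩
  · exact ⟨S, key _ (by simp [heS]) (by simp [hfS, heS]), by simp [heS]⟩

theorem exists_isComponent (hM : M.Finite) (hE : M.E.Nonempty) : ∃ S, IsComponent M S := by
  have hfin : {S | S.Nonempty ∧ IsSeparator M S}.Finite :=
    hM.ground_finite.powerset.subset fun S hS => hS.2.1
  obtain ⟨S, -, hS⟩ := hfin.exists_le_minimal (a := M.E)
    ⟨hE, Subset.rfl, fun C hC => Or.inl hC.subset_ground⟩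
  exact ⟨S, hS⟩

/-! ### Dismantling quasi series-parallel matroids -/

/-- Matroids that can be dismantled to the empty matroid by removing loops, coloops, elements
with a parallel element, and elements with a series element, one at a time. For finite matroids
this is the same as being quasi series-parallel. -/
inductive IsSPReducible : Matroid α → Prop
  | empty (M : Matroid α) (hM : M.E = ∅) : IsSPReducible M
  | loop (M : Matroid α) (e : α) (he : M.IsLoop e) (h : IsSPReducible (M ＼ {e})) :
      IsSPReducible M
  | coloop (M : Matroid α) (e : α) (he : M.IsColoop e) (h : IsSPReducible (M ／ {e})) :
      IsSPReducible M
  | parallel (M : Matroid α) (e f : α) (hne : e ≠ f) (hM : M.IsCircuit {e, f})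
      (h : IsSPReducible (M ＼ {e})) : IsSPReducible M
  | series (M : Matroid α) (e f : α) (hne : e ≠ f) (hM : M.IsCocircuit {e, f})
      (h : IsSPReducible (M ／ {e})) : IsSPReducible M

theorem IsSPReducible.dual (h : IsSPReducible M) : IsSPReducible M✶ := by
  induction h with
  | empty M hM => exact .empty _ (by simpa using hM)
  | loop M e he _ ih => exact .coloop _ e he.dual_isColoop (by rwa [← dual_delete])
  | coloop M e he _ ih => exact .loop _ e he.dual_isLoop (by rwa [← dual_contract])
  | parallel M e f hne hM _ ih => exact .series _ e f hne hM.isCocircuit (by rwa [← dual_delete])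
  | series M e f hne hM _ ih => exact .parallel _ e f hne hM.isCircuit (by rwa [← dual_contract])

theorem IsSeriesParallel.dual (h : IsSeriesParallel M) : IsSeriesParallel M✶ := by
  induction h with
  | loop e => simpa using .coloop e
  | coloop e => simpa using .loop e
  | parallel M e f hne hM _ ih => exact .series _ e f hne hM.isCocircuit (by rwa [← dual_delete])
  | series M e f hne hM _ ih => exact .parallel _ e f hne hM.isCircuit (by rwa [← dual_contract])

theorem IsQuasiSeriesParallel.dual (h : IsQuasiSeriesParallel M) : IsQuasiSeriesParallel M✶ := by
  intro S hS
  rw [isComponent_dual_iff] at hS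
  rw [hS.isSeparator.dual_restrict]
  exact (h S hS).dual

theorem delete_restrict_eq {D : Set α} (hS : S ⊆ M.E \ D) : (M ＼ D) ↾ S = M ↾ S := by
  rw [delete_eq_restrict, restrict_restrict_eq _ hS]

theorem restrict_delete_eq {D : Set α} : (M ↾ S) ＼ D = M ↾ (S \ D) := by
  rw [delete_eq_restrict, restrict_ground_eq, restrict_restrict_eq _ sdiff_subset]

theorem IsQuasiSeriesParallel.delete_loop (h : IsQuasiSeriesParallel M) (he : M.IsLoop e) :
    IsQuasiSeriesParallel (M ＼ {e}) := by
  intro S hS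
  rw [delete_restrict_eq hS.isSeparator.1]
  exact h S ((isComponent_delete_loop_iff he).1 hS).1

theorem IsQuasiSeriesParallel.of_delete_loop (he : M.IsLoop e)
    (h : IsQuasiSeriesParallel (M ＼ {e})) : IsQuasiSeriesParallel M := by
  intro S hS
  by_cases heS : e ∈ S
  · have : S ⊆ {e} := hS.subset_of_isSeparator (singleton_nonempty e) (isSeparator_singleton he)
      (singleton_subset_iff.2 heS)
    have hSe : S = {e} := this.antisymm (singleton_subset_iff.2 heS)
    rw [hSe, restrict_subset_loops_eq (singleton_subset_iff.2 he)]
    exact .loop e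
  · have h1 := (isComponent_delete_loop_iff he).2 ⟨hS, heS⟩
    rw [← delete_restrict_eq h1.isSeparator.1]
    exact h S h1

theorem IsQuasiSeriesParallel.of_delete_parallel (hne : e ≠ f) (hef : M.IsCircuit {e, f})
    (h : IsQuasiSeriesParallel (M ＼ {e})) : IsQuasiSeriesParallel M := by
  intro S hS
  have h1 := isComponent_sdiff_of_parallel hne hef hS
  have h2 := h _ h1
  rw [delete_restrict_eq h1.isSeparator.1] at h2
  by_cases heS : e ∈ S
  · refine .parallel _ e f hne (hef.isCircuit_restrict_of_subset ?_) (by rwa [restrict_delete_eq])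
    rw [pair_subset_iff]
    exact ⟨heS, (hS.isSeparator.mem_iff_of_isCircuit hef).1 heS⟩
  · rwa [sdiff_singleton_eq_self heS] at h2

theorem IsQuasiSeriesParallel.delete_parallel (h : IsQuasiSeriesParallel M) (hS : IsComponent M S)
    (hne : e ≠ f) (hef : (M ↾ S).IsCircuit {e, f}) (hSe : IsSeriesParallel ((M ↾ S) ＼ {e})) :
    IsQuasiSeriesParallel (M ＼ {e}) := by
  rw [restrict_isCircuit_iff hS.isSeparator.1] at hef
  intro T hT
  rw [delete_restrict_eq hT.isSeparator.1]
  obtain ⟨U, hU, rfl⟩ := exists_isComponent_of_isComponent_delete_parallel hne hef.1 hT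
  by_cases heU : e ∈ U
  · have heS : e ∈ S := hef.2 (by simp)
    have hUS : U = S := by
      refine subset_antisymm ((hU.subset_or_disjoint hS.isSeparator).resolve_right ?_)
        ((hS.subset_or_disjoint hU.isSeparator).resolve_right ?_)
      · exact not_disjoint_iff.2 ⟨e, heU, heS⟩
      · exact not_disjoint_iff.2 ⟨e, heS, heU⟩
    rwa [hUS, ← restrict_delete_eq]
  · rw [sdiff_singleton_eq_self heU]
    exact h U hU

theorem IsSPReducible.isQuasiSeriesParallel (h : IsSPReducible M) : IsQuasiSeriesParallel M := by
  induction h with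
  | empty M hM =>
    intro S hS
    obtain ⟨x, hx⟩ := hS.prop.1
    simpa [hM] using hS.isSeparator.1 hx
  | loop M e he _ ih => exact .of_delete_loop he ih
  | coloop M e he _ ih =>
    have := ih.dual
    rw [dual_contract] at this
    simpa using (IsQuasiSeriesParallel.of_delete_loop he.dual_isLoop this).dual
  | parallel M e f hne hM _ ih => exact .of_delete_parallel hne hM ih
  | series M e f hne hM _ ih =>
    have := ih.dual
    rw [dual_contract] at this
    simpa using (IsQuasiSeriesParallel.of_delete_parallel hne hM.isCircuit this).dual

/-- Each component of the matroid ends its construction with a step that can be undone in the whole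
matroid. -/
theorem IsQuasiSeriesParallel.isSPReducible (hM : M.Finite) (h : IsQuasiSeriesParallel M) :
    IsSPReducible M := by
  suffices H : ∀ n, ∀ M : Matroid α, M.Finite → M.E.ncard = n → IsQuasiSeriesParallel M →
      IsSPReducible M from H _ M hM rfl h
  intro n
  induction n using Nat.strong_induction_on with
  | _ n ih =>
  intro M hM hn h
  have hlt : ∀ {e}, e ∈ M.E → (M.E \ {e}).ncard < n := fun he => by
    rw [← hn]
    exact ncard_sdiff_singleton_lt_of_mem he hM.ground_finite
  rcases M.E.eq_empty_or_nonempty with hE | hE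
  · exact .empty M hE
  obtain ⟨S, hS⟩ := exists_isComponent hM hE
  have hN := h S hS
  generalize hNS : M ↾ S = N at hN
  cases hN with
  | loop e =>
    have he : M.IsLoop e := by
      have h1 : (M ↾ S).IsLoop e := by rw [hNS]; simp
      rw [restrict_isLoop_iff] at h1
      exact h1.2.resolve_right fun h2 => h2 (hS.isSeparator.1 h1.1)
    exact .loop M e he (ih _ (hlt he.mem_ground) _ inferInstance rfl (h.delete_loop he))
  | coloop e =>
    have he : M✶.IsLoop e := by
      have h1 : (M✶ ↾ S).IsLoop e := by rw [hS.isSeparator.dual_restrict, hNS]; simp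
      rw [restrict_isLoop_iff] at h1
      exact h1.2.resolve_right fun h2 => h2 (hS.isSeparator.1 h1.1)
    have h2 := (h.dual.delete_loop he).dual
    rw [dual_delete_dual] at h2
    exact .coloop M e he (ih _ (hlt he.mem_ground) _ inferInstance rfl h2)
  | parallel _ e f hne hef hSe =>
    have h2 := h.delete_parallel hS hne (hNS ▸ hef) (hNS ▸ hSe)
    rw [← hNS, restrict_isCircuit_iff hS.isSeparator.1] at hef
    exact .parallel M e f hne hef.1
      (ih _ (hlt (hef.1.subset_ground (by simp))) _ inferInstance rfl h2)
  | series _ e f hne hef hSe =>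
    have hd := hS.isSeparator.dual_restrict
    have hef' : (M✶ ↾ S).IsCircuit {e, f} := by rw [hd, hNS]; exact hef.isCircuit
    have hSe' := hSe.dual
    rw [dual_contract, ← hNS, ← hd] at hSe'
    have h2 := (h.dual.delete_parallel (isComponent_dual_iff.2 hS) hne hef' hSe').dual
    rw [dual_delete_dual] at h2
    rw [restrict_isCircuit_iff (M := M✶) hS.isSeparator.1] at hef'
    exact .series M e f hne hef'.1
      (ih _ (hlt (hef'.1.subset_ground (by simp))) _ inferInstance rfl h2)

theorem isQuasiSeriesParallel_iff [M.Finite] : IsQuasiSeriesParallel M ↔ IsSPReducible M :=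
  ⟨fun h => h.isSPReducible inferInstance, fun h => h.isQuasiSeriesParallel⟩

/-! ### Loops and parallel pairs in minors -/

theorem isNonloop_left_of_isCircuit_pair (hne : e ≠ f) (h : M.IsCircuit {e, f}) :
    M.IsNonloop e :=
  h.isNonloop_of_mem (nontrivial_pair hne) (by simp)

theorem isCircuit_pair_delete (h : M.IsCircuit {e, f}) (hae : a ≠ e) (haf : a ≠ f) :
    (M ＼ {a}).IsCircuit {e, f} :=
  delete_isCircuit_iff.2 ⟨h, by simp [hae, haf]⟩

theorem IsSPReducible.delete_loop [M.Finite] (h : IsSPReducible M) (he : M.IsLoop e) :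
    IsSPReducible (M ＼ {e}) := by
  rw [← isQuasiSeriesParallel_iff] at h ⊢
  exact h.delete_loop he

/-- Contraction of a member of a series pair does not affect a disjoint parallel pair. -/
theorem isCircuit_pair_contract (hne : e ≠ f) (hef : M.IsCircuit {e, f})
    (hK : M.IsCocircuit {a, b}) (hae : a ≠ e) (hbe : b ≠ e) :
    (M ／ {a}).IsCircuit {e, f} := by
  have he := isNonloop_left_of_isCircuit_pair hne hef
  have hcl := (he.closure_eq_closure_iff_isCircuit_of_ne hne).2 hef
  have hecl : e ∉ M.closure {a} := by
    intro h
    have h1 := (he.closure_eq_closure_iff_isCircuit_of_ne hae.symm).1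
      (he.closure_eq_of_mem_closure h)
    refine h1.inter_isCocircuit_ne_singleton hK (e := a) ?_
    ext x
    simp only [mem_inter_iff, mem_insert_iff, mem_singleton_iff]
    grind
  have he' : (M ／ {a}).IsNonloop e := by
    rw [contract_isNonloop_iff]
    exact ⟨he.mem_ground, hecl⟩
  rw [← he'.closure_eq_closure_iff_isCircuit_of_ne hne, contract_closure_eq, contract_closure_eq,
    closure_union_congr_left hcl]

/-! ### Maps and pullbacks of matroids -/

theorem closure_image_eq_of_closure_singleton_eq {h : α → α}
    (hcl : ∀ x, M.closure {h x} = M.closure {x}) (X : Set α) :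
    M.closure (h '' X) = M.closure X := by
  have h1 := M.closure_biUnion_closure_eq_closure_biUnion (fun x => {h x}) X
  have h2 := M.closure_biUnion_closure_eq_closure_biUnion (fun x => {x}) X
  simp only [hcl] at h1
  rw [h1] at h2
  simpa only [← image_eq_iUnion, image_id'] using h2

/-- Replacing elements by parallel elements does not change a matroid. -/
theorem comap_eq_self {h : α → α} (hE : h ⁻¹' M.E = M.E)
    (hcl : ∀ x, M.closure {h x} = M.closure {x}) : M.comap h = M := by
  refine ext_closure fun X => ?_
  rw [comap_closure_eq, closure_image_eq_of_closure_singleton_eq hcl]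
  ext x
  by_cases hx : x ∈ M.E
  · have hhx : h x ∈ M.E := by rwa [← hE] at hx
    rw [mem_preimage, ← singleton_subset_iff, ← closure_subset_closure_iff_subset_closure, hcl,
      closure_subset_closure_iff_subset_closure, singleton_subset_iff]
  · have hhx : h x ∉ M.E := by rwa [← hE] at hx
    exact ⟨fun h => absurd (mem_ground_of_mem_closure h) hhx,
      fun h => absurd (mem_ground_of_mem_closure h) hx⟩

theorem comap_delete (N : Matroid β) (g : α → β) (D : Set β) :
    (N ＼ D).comap g = N.comap g ＼ (g ⁻¹' D) := by
  refine ext_closure fun X => ?_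
  rw [comap_closure_eq, delete_closure_eq, delete_closure_eq, comap_closure_eq,
    image_sdiff_preimage, preimage_sdiff]

theorem comap_contract (N : Matroid β) (g : α → β) {G : Set β} (hG : G ⊆ range g) :
    (N ／ G).comap g = N.comap g ／ (g ⁻¹' G) := by
  refine ext_closure fun X => ?_
  rw [comap_closure_eq, contract_closure_eq, contract_closure_eq, comap_closure_eq,
    image_union, image_preimage_eq_of_subset hG, preimage_sdiff]

theorem map_delete_image (g : α → β) (hg : InjOn g M.E) {D : Set α} (hD : D ⊆ M.E) :
    M.map g hg ＼ (g '' D) = (M ＼ D).map g (hg.mono sdiff_subset) := by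
  refine ext_indep (by simp [hg.image_sdiff_subset hD]) fun I _ => ?_
  simp only [delete_indep_iff, map_indep_iff]
  constructor
  · rintro ⟨⟨J, hJ, rfl⟩, h⟩
    exact ⟨J, ⟨hJ, h.of_image⟩, rfl⟩
  · rintro ⟨J, ⟨hJ, h⟩, rfl⟩
    refine ⟨⟨J, hJ, rfl⟩, disjoint_left.2 ?_⟩
    rintro _ ⟨x, hx, rfl⟩ ⟨y, hy, hxy⟩
    exact disjoint_left.1 h hx (hg (hD hy) (hJ.subset_ground hx) hxy ▸ hy)

theorem map_contract_image (g : α → β) (hg : InjOn g M.E) {D : Set α} (hD : D ⊆ M.E) :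
    M.map g hg ／ (g '' D) = (M ／ D).map g (hg.mono sdiff_subset) := by
  rw [← dual_inj, dual_contract, map_dual, map_dual]
  have := map_delete_image (M := M✶) g hg hD
  simp only [dual_contract]
  exact this

theorem map_isCircuit (g : α → β) (hg : InjOn g M.E) (hC : M.IsCircuit C) :
    (M.map g hg).IsCircuit (g '' C) := by
  refine ⟨map_dep_iff.2 ⟨C, hC.dep, rfl⟩, fun D hD hDC => ?_⟩
  obtain ⟨D, hD', rfl⟩ := map_dep_iff.1 hD
  rw [hg.image_subset_image_iff hD'.subset_ground hC.subset_ground] at hDC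
  rw [hC.eq_of_dep_subset hD' hDC]

theorem IsSPReducible.map (h : IsSPReducible M) (g : α → β) (hg : InjOn g M.E) :
    IsSPReducible (M.map g hg) := by
  induction h with
  | empty M hM => exact .empty _ (by simp [hM])
  | loop M e he _ ih =>
    refine .loop _ (g e) ((map_isLoop_iff he.mem_ground).2 he) ?_
    rw [← image_singleton, map_delete_image g hg (singleton_subset_iff.2 he.mem_ground)]
    exact ih _
  | coloop M e he _ ih =>
    refine .coloop _ (g e) ?_ ?_
    · rw [IsColoop, map_dual]
      exact (map_isLoop_iff (M := M✶) he.mem_ground).2 he.dual_isLoop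
    · rw [← image_singleton, map_contract_image g hg (singleton_subset_iff.2 he.mem_ground)]
      exact ih _
  | parallel M e f hne hM _ ih =>
    have heE : e ∈ M.E := hM.subset_ground (by simp)
    refine .parallel _ (g e) (g f) (fun h => hne ?_) ?_ ?_
    · exact hg heE (hM.subset_ground (by simp)) h
    · rw [← image_pair]
      exact map_isCircuit g hg hM
    · rw [← image_singleton, map_delete_image g hg (singleton_subset_iff.2 heE)]
      exact ih _
  | series M e f hne hM _ ih =>
    have heE : e ∈ M.E := hM.subset_ground (by simp)
    refine .series _ (g e) (g f) (fun h => hne ?_) ?_ ?_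
    · exact hg heE (hM.subset_ground (by simp)) h
    · rw [← image_pair, isCocircuit_def, map_dual]
      exact map_isCircuit (M := M✶) g hg hM.isCircuit
    · rw [← image_singleton, map_contract_image g hg (singleton_subset_iff.2 heE)]
      exact ih _

theorem isSPReducible_map_iff {g : α → β} (hg : InjOn g M.E) :
    IsSPReducible (M.map g hg) ↔ IsSPReducible M := by
  refine ⟨fun h => ?_, fun h => h.map g hg⟩
  rcases isEmpty_or_nonempty α with _ | _
  · exact .empty M (eq_empty_of_isEmpty _)
  have hinv : ∀ J ⊆ M.E, Function.invFunOn g M.E '' (g '' J) = J := fun J hJ => by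
    rw [image_image]
    conv_rhs => rw [← image_id J]
    exact image_congr fun x hx => hg.leftInvOn_invFunOn (hJ hx)
  have h1 : InjOn (Function.invFunOn g M.E) (M.map g hg).E := by
    rw [map_ground]
    exact hg.leftInvOn_invFunOn.rightInvOn_image.injOn
  convert h.map _ h1
  refine ext_indep (by simp [hinv]) fun I hI => ?_
  simp only [map_indep_iff]
  constructor
  · exact fun h => ⟨_, ⟨I, h, rfl⟩, (hinv I hI).symm⟩
  · rintro ⟨_, ⟨J, hJ, rfl⟩, rfl⟩
    rwa [hinv J hJ.subset_ground]

/-! ### Closure under deletion of parallel elements -/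

/-- The transposition of two parallel elements is an automorphism. -/
theorem delete_parallel_eq_map_swap [DecidableEq α] (hne : e ≠ f) (h : M.IsCircuit {e, f}) :
    M ＼ {e} = (M ＼ {f}).map (Equiv.swap e f) (Equiv.swap e f).injective.injOn := by
  have he := isNonloop_left_of_isCircuit_pair hne h
  have hf := isNonloop_left_of_isCircuit_pair hne.symm (pair_comm e f ▸ h)
  have hcl := (he.closure_eq_closure_iff_isCircuit_of_ne hne).2 h
  have hM : M.comap (Equiv.swap e f) = M := by
    refine comap_eq_self ?_ fun x => ?_
    · ext x
      rw [mem_preimage]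
      by_cases hxe : x = e
      · simp [hxe, he.mem_ground, hf.mem_ground]
      by_cases hxf : x = f
      · simp [hxf, he.mem_ground, hf.mem_ground]
      rw [Equiv.swap_apply_of_ne_of_ne hxe hxf]
    · by_cases hxe : x = e
      · simp [hxe, hcl]
      by_cases hxf : x = f
      · simp [hxf, hcl]
      rw [Equiv.swap_apply_of_ne_of_ne hxe hxf]
  have h1 : (M ＼ {e}).comap (Equiv.swap e f) = M ＼ {f} := by
    rw [comap_delete, hM]
    congr 1
    ext x
    simp [Equiv.swap_apply_eq_iff]
  have h2 := map_comap (N := M ＼ {e}) (f := Equiv.swap e f) (by simp)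
    (Equiv.swap e f).injective.injOn
  simp only [h1] at h2
  exact h2.symm

/-- The class of reducible matroids is closed under deletion of a parallel element, no matter how
it was built. -/
theorem IsSPReducible.delete_parallel (h : IsSPReducible M) (hfin : M.Finite) (hne : e ≠ f)
    (hef : M.IsCircuit {e, f}) : IsSPReducible (M ＼ {e}) := by
  induction h generalizing e f with
  | empty M hM =>
    have := hef.subset_ground (mem_insert e _)
    simp [hM] at this
  | loop M a ha h ih =>
    have hae : a ≠ e := by
      rintro rfl
      exact (isNonloop_left_of_isCircuit_pair hne hef).not_isLoop ha
    have haf : a ≠ f := by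
      rintro rfl
      exact (isNonloop_left_of_isCircuit_pair hne.symm (pair_comm e a ▸ hef)).not_isLoop ha
    have h1 := ih inferInstance hne (isCircuit_pair_delete hef hae haf)
    rw [delete_comm] at h1
    exact .loop _ a (delete_isLoop_iff.2 ⟨ha, hae⟩) h1
  | coloop M a ha h ih =>
    have hae := ha.notMem_isCircuit hef
    simp only [mem_insert_iff, mem_singleton_iff, not_or] at hae
    have h1 := ih inferInstance hne (by
      rw [contract_eq_delete_of_subset_coloops (singleton_subset_iff.2 ha)]
      exact isCircuit_pair_delete hef hae.1 hae.2)
    rw [contract_delete_comm _ (by simpa using hae.1)] at h1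
    refine .coloop _ a ?_ h1
    rw [IsColoop, dual_delete, contract_isLoop_iff_mem_closure]
    exact ⟨ha.dual_isLoop.mem_closure _, hae.1⟩
  | parallel M a b hab hM h ih =>
    by_cases hae : a = e
    · exact hae ▸ h
    by_cases haf : a = f
    · subst haf
      by_cases hbe : b = e
      · classical
        rw [delete_parallel_eq_map_swap hne hef]
        exact h.map _ _
      · have he := isNonloop_left_of_isCircuit_pair hne hef
        have ha := isNonloop_left_of_isCircuit_pair hab hM
        have heb : M.IsCircuit {e, b} := by
          rw [← he.closure_eq_closure_iff_isCircuit_of_ne (Ne.symm hbe),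
            (he.closure_eq_closure_iff_isCircuit_of_ne hne).2 hef,
            (ha.closure_eq_closure_iff_isCircuit_of_ne hab).2 hM]
        have h1 := ih inferInstance (Ne.symm hbe)
          (isCircuit_pair_delete heb hae hab)
        rw [delete_comm] at h1
        exact .parallel _ a b hab (isCircuit_pair_delete hM (Ne.symm hae) (Ne.symm hbe)) h1
    have h1 := ih inferInstance hne
      (isCircuit_pair_delete hef hae haf)
    rw [delete_comm] at h1
    by_cases hbe : b = e
    · subst hbe
      have ha := isNonloop_left_of_isCircuit_pair hab hM
      have hb := isNonloop_left_of_isCircuit_pair hne hef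
      have haf' : M.IsCircuit {a, f} := by
        rw [← ha.closure_eq_closure_iff_isCircuit_of_ne haf,
            (ha.closure_eq_closure_iff_isCircuit_of_ne hab).2 hM,
            (hb.closure_eq_closure_iff_isCircuit_of_ne hne).2 hef]
      exact .parallel _ a f haf (isCircuit_pair_delete haf' (Ne.symm hae) hne) h1
    · exact .parallel _ a b hab (isCircuit_pair_delete hM (Ne.symm hae) (Ne.symm hbe)) h1
  | series M a b hab hK h ih =>
    have hint := fun x => hef.inter_isCocircuit_ne_singleton hK (e := x)
    have he := isNonloop_left_of_isCircuit_pair hne hef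
    have hef' : M.IsCircuit {f, e} := pair_comm e f ▸ hef
    have hf := isNonloop_left_of_isCircuit_pair hne.symm hef'
    have hcl := (he.closure_eq_closure_iff_isCircuit_of_ne hne).2 hef
    -- in the two degenerate cases `{e, f}` is a circuit as well as a cocircuit
    have hcolp : M.IsCocircuit {e, f} → (M ＼ {e}).IsColoop f := fun hK => by
      rw [← singleton_isCocircuit]
      convert hK.delete_isCocircuit (D := {e}) ⟨by simp, fun h => hne.symm (h (by simp))⟩ using 1
      rw [pair_sdiff_left hne]
    have hloop : (M ／ {f}).IsLoop e := by
      rw [contract_isLoop_iff_mem_closure, ← hcl]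
      exact ⟨mem_closure_self _ _ he.mem_ground, hne⟩
    by_cases hae : a = e
    · subst hae
      have hbf : b = f := by
        by_contra hbf
        refine hint a ?_
        ext x
        simp only [mem_inter_iff, mem_insert_iff, mem_singleton_iff]
        grind
      subst hbf
      have hloop' : (M ／ {a}).IsLoop b := by
        rw [contract_isLoop_iff_mem_closure, hcl]
        exact ⟨mem_closure_self _ _ hf.mem_ground, hne.symm⟩
      refine .coloop _ b (hcolp hK) ?_
      rw [← contract_delete_comm _ (by simpa using hne.symm),
        ← contract_eq_delete_of_subset_loops (singleton_subset_iff.2 hloop), contract_comm,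
        contract_eq_delete_of_subset_loops (singleton_subset_iff.2 hloop')]
      exact h.delete_loop hloop'
    by_cases haf : a = f
    · subst haf
      have hbe : b = e := by
        by_contra hbe
        refine hint a ?_
        ext x
        simp only [mem_inter_iff, mem_insert_iff, mem_singleton_iff]
        grind
      subst hbe
      refine .coloop _ a (hcolp (pair_comm a b ▸ hK)) ?_
      rw [← contract_delete_comm _ (by simpa using hne.symm)]
      exact h.delete_loop hloop
    have hb : b ≠ e ∧ b ≠ f := by
      constructor <;> rintro rfl
      all_goals
        refine hint b ?_
        ext x
        simp only [mem_inter_iff, mem_insert_iff, mem_singleton_iff]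
        grind
    have h1 := ih inferInstance hne (isCircuit_pair_contract hne hef hK hae hb.1)
    rw [contract_delete_comm _ (by simpa using hae)] at h1
    refine .series _ a b hab ?_ h1
    rw [isCocircuit_def, dual_delete]
    exact isCircuit_pair_contract (M := M✶) hab hK.isCircuit hef.isCocircuit
      (Ne.symm hae) (Ne.symm haf)

/-- Deletion of an element does not change reducibility if another element has the same closure. -/
theorem isSPReducible_delete_iff_of_closure_eq [M.Finite] (he : e ∈ M.E) (hne : e ≠ f)
    (hcl : M.closure {e} = M.closure {f}) : IsSPReducible (M ＼ {e}) ↔ IsSPReducible M := by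
  by_cases hloop : M.IsLoop e
  · exact ⟨.loop M e hloop, fun h => h.delete_loop hloop⟩
  · have hef := (((not_isLoop_iff he).1 hloop).closure_eq_closure_iff_isCircuit_of_ne hne).1 hcl
    exact ⟨.parallel M e f hne hef, fun h => h.delete_parallel inferInstance hne hef⟩

theorem isSPReducible_delete_iff [M.Finite] {D : Set α} (hD : D.Finite) (hDE : D ⊆ M.E)
    (h : ∀ e ∈ D, ∃ f ∉ D, M.closure {e} = M.closure {f}) :
    IsSPReducible (M ＼ D) ↔ IsSPReducible M := by
  induction D, hD using Set.Finite.induction_on with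
  | empty => simp
  | @insert a D haD _ ih =>
    have hsub : ∀ e ∈ insert a D, ∃ f ∉ D, M.closure {e} = M.closure {f} := fun e he => by
      obtain ⟨f, hf, h1⟩ := h e he
      exact ⟨f, fun h => hf (mem_insert_of_mem _ h), h1⟩
    obtain ⟨f, hf, h1⟩ := h a (mem_insert _ _)
    rw [← ih ((subset_insert _ _).trans hDE) fun e he => hsub e (mem_insert_of_mem _ he),
      ← union_singleton, ← delete_delete]
    have hfD : f ∉ D := fun h => hf (mem_insert_of_mem _ h)
    refine isSPReducible_delete_iff_of_closure_eq (f := f) ⟨hDE (mem_insert _ _), haD⟩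
      (fun h => hf (h ▸ mem_insert _ _)) ?_
    rw [delete_closure_eq, delete_closure_eq, sdiff_eq_left.2 (disjoint_singleton_left.2 haD),
      sdiff_eq_left.2 (disjoint_singleton_left.2 hfD), h1]

/-! ### Pullbacks along surjections -/

theorem comap_comap {γ : Type*} (N : Matroid γ) (g : β → γ) (h : α → β) :
    (N.comap g).comap h = N.comap (g ∘ h) := by
  refine ext_closure fun X => ?_
  rw [comap_closure_eq, comap_closure_eq, comap_closure_eq, image_comp, preimage_comp]

theorem closure_comap_singleton (N : Matroid β) (g : α → β) (x y : α) (hg : Function.Surjective g) :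
    (N.comap g).closure {x} = (N.comap g).closure {y} ↔ N.closure {g x} = N.closure {g y} := by
  rw [comap_closure_eq, comap_closure_eq, image_singleton, image_singleton,
    hg.preimage_injective.eq_iff]

theorem comap_delete_compl_range {N : Matroid β} (hN : N.E = univ) {g : α → β} {s : β → α}
    (hs : Function.RightInverse s g) :
    N.comap g ＼ (range s)ᶜ = N.map s hs.injective.injOn := by
  refine ext_indep (by simp [hN]) fun I hI => ?_
  rw [delete_ground, comap_ground_eq, hN, preimage_univ, ← compl_eq_univ_sdiff, compl_compl] at hI
  obtain ⟨J, rfl⟩ := subset_range_iff_exists_image_eq.1 hI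
  have hJ : g '' (s '' J) = J := by simp [image_image, hs _]
  rw [delete_indep_iff, comap_indep_iff, hJ, map_image_indep_iff (by simp [hN])]
  refine ⟨fun h => h.1.1, fun h => ⟨⟨h, ?_⟩, ?_⟩⟩
  · rintro _ ⟨x, -, rfl⟩ _ ⟨y, -, rfl⟩ hxy
    rw [hs, hs] at hxy
    rw [hxy]
  · rw [disjoint_compl_right_iff_subset]
    exact hI

/-- Being reducible depends only on the simplification: all but one of the elements of each fibre
are loops or parallel to the remaining one, and can be deleted. -/
theorem isSPReducible_comap_iff [Finite α] {N : Matroid β} (hN : N.E = univ) {g : α → β}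
    (hg : Function.Surjective g) : IsSPReducible (N.comap g) ↔ IsSPReducible N := by
  obtain ⟨s, hs⟩ := hg.hasRightInverse
  have : (N.comap g).Finite := ⟨toFinite _⟩
  rw [← isSPReducible_delete_iff (D := (range s)ᶜ) (toFinite _) (by simp [hN]),
    comap_delete_compl_range hN hs, isSPReducible_map_iff]
  intro e _
  refine ⟨s (g e), by simp, ?_⟩
  rw [comap_closure_eq, comap_closure_eq, image_singleton, image_singleton, hs]

/-! ### Rank -/

theorem rank_eq_ncard {B : Set α} (hB : M.IsBase B) : rank M = B.ncard := by
  rw [rank, ← hB.encard_eq_eRank, ncard]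

theorem ncard_le_rank [M.Finite] (hI : M.Indep I) : I.ncard ≤ rank M := by
  obtain ⟨B, hB, hIB⟩ := hI.exists_isBase_superset
  rw [rank_eq_ncard hB]
  exact ncard_le_ncard hIB (M.ground_finite.subset hB.subset_ground)

theorem rank_delete_le [M.Finite] (D : Set α) : rank (M ＼ D) ≤ rank M := by
  obtain ⟨B, hB⟩ := (M ＼ D).exists_isBase
  rw [rank_eq_ncard hB]
  exact ncard_le_rank (delete_indep_iff.1 hB.indep).1

theorem rank_contract_singleton [M.Finite] (he : M.IsNonloop e) :
    rank (M ／ {e}) + 1 = rank M := by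
  obtain ⟨B, hB⟩ := (M ／ {e}).exists_isBase
  have h1 := (indep_singleton.2 he).contract_isBase_iff.1 hB
  rw [rank_eq_ncard hB, rank_eq_ncard h1.1, union_singleton,
    ncard_insert_of_notMem (by simpa using h1.2)
      ((M ／ {e}).ground_finite.subset hB.subset_ground)]

theorem rank_dual_add [M.Finite] : rank M✶ + rank M = M.E.ncard := by
  obtain ⟨B, hB⟩ := M.exists_isBase
  rw [rank_eq_ncard hB, rank_eq_ncard hB.compl_isBase_dual]
  exact ncard_sdiff_add_ncard_of_subset hB.subset_ground M.ground_finite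

theorem rank_le_ncard [M.Finite] : rank M ≤ M.E.ncard :=
  le_of_le_of_eq (Nat.le_add_left _ _) rank_dual_add

theorem rank_comap {N : Matroid β} {g : α → β} (hg : N.E ⊆ range g) :
    rank (N.comap g) = rank N := by
  rw [rank, rank, ← eRk_ground, ← eRk_ground, eRk_comap, comap_ground_eq,
    image_preimage_eq_of_subset hg]

/-! ### The size of simple quasi series-parallel matroids -/

/-- A simple restriction of a reducible matroid of rank `r` has at most `2 r - 1` elements. -/
theorem IsSPReducible.ncard_lt (h : IsSPReducible M) (hfin : M.Finite)
    (hT : ∀ x ∈ T, M.IsNonloop x) (hT2 : ∀ x ∈ T, ∀ y ∈ T, x ≠ y → ¬ M.IsCircuit {x, y})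
    (hne : T.Nonempty) : T.ncard < 2 * rank M := by
  induction h generalizing T with
  | empty M hM =>
    obtain ⟨x, hx⟩ := hne
    have := (hT x hx).mem_ground
    simp [hM] at this
  | loop M e he _ ih =>
    have h1 := ih (T := T) inferInstance
      (fun x hx => delete_isNonloop_iff.2
        ⟨hT x hx, fun h => (hT x hx).not_isLoop (mem_singleton_iff.1 h ▸ he)⟩)
      (fun x hx y hy hxy hc => hT2 x hx y hy hxy hc.of_delete) hne
    have := rank_delete_le (M := M) {e}
    omega
  | coloop M e he _ ih =>
    have hTfin : T.Finite := M.ground_finite.subset fun x hx => (hT x hx).mem_ground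
    have hr := rank_contract_singleton he.isNonloop
    have h2 := ncard_le_ncard_sdiff_add_ncard T {e}
    rw [ncard_singleton] at h2
    rcases (T \ {e}).eq_empty_or_nonempty with h1 | h1
    · rw [h1, ncard_empty] at h2
      omega
    rw [contract_eq_delete_of_subset_coloops (singleton_subset_iff.2 he)] at ih hr
    have := ih inferInstance (T := T \ {e}) (fun x hx => delete_isNonloop_iff.2 ⟨hT x hx.1, hx.2⟩)
      (fun x hx y hy hxy hc => hT2 x hx.1 y hy.1 hxy hc.of_delete) h1
    omega
  | parallel M e f hef hM _ ih =>
    have hTfin : T.Finite := M.ground_finite.subset fun x hx => (hT x hx).mem_ground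
    have hr := rank_delete_le (M := M) {e}
    have he := isNonloop_left_of_isCircuit_pair hef hM
    have hM' : M.IsCircuit {f, e} := pair_comm e f ▸ hM
    have hf := isNonloop_left_of_isCircuit_pair hef.symm hM'
    by_cases heT : e ∈ T
    · have hfT : f ∉ T := fun hfT => hT2 e heT f hfT hef hM
      have hpar : ∀ x ∈ T, x ≠ e → ¬ M.IsCircuit {x, f} := by
        intro x hx hxe hc
        have hxf : x ≠ f := fun h => hfT (h ▸ hx)
        refine hT2 x hx e heT hxe ?_
        rw [← (hT x hx).closure_eq_closure_iff_isCircuit_of_ne hxe,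
          ((hT x hx).closure_eq_closure_iff_isCircuit_of_ne hxf).2 hc,
          (hf.closure_eq_closure_iff_isCircuit_of_ne hef.symm).2 hM']
      have h1 := ih inferInstance (T := insert f (T \ {e})) ?_ ?_ (insert_nonempty _ _)
      · rw [ncard_insert_of_notMem (fun h => hfT h.1) hTfin.sdiff,
          ncard_sdiff_singleton_add_one heT hTfin] at h1
        omega
      · rintro x (rfl | hx)
        · exact delete_isNonloop_iff.2 ⟨hf, hef.symm⟩
        · exact delete_isNonloop_iff.2 ⟨hT x hx.1, hx.2⟩
      · rintro x (rfl | hx) y (rfl | hy) hxy hc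
        · exact hxy rfl
        · rw [pair_comm] at hc
          exact hpar y hy.1 hy.2 hc.of_delete
        · exact hpar x hx.1 hx.2 hc.of_delete
        · exact hT2 x hx.1 y hy.1 hxy hc.of_delete
    · have h1 := ih inferInstance (T := T)
        (fun x hx => delete_isNonloop_iff.2 ⟨hT x hx, fun h => heT (h ▸ hx)⟩)
        (fun x hx y hy hxy hc => hT2 x hx y hy hxy hc.of_delete) hne
      omega
  | series M e f hef hK _ ih =>
    have hTfin : T.Finite := M.ground_finite.subset fun x hx => (hT x hx).mem_ground
    have he : M.IsNonloop e := hK.isNonloop_of_mem (by simp)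
    have hr := rank_contract_singleton he
    have h2 := ncard_le_ncard_sdiff_add_ncard T {e, f}
    rw [ncard_pair hef] at h2
    -- by orthogonality, a circuit that contains `e` also contains `f`
    have hmem : ∀ C, M.IsCircuit C → e ∈ C → f ∈ C := by
      intro C hC heC
      by_contra hfC
      refine hC.inter_isCocircuit_ne_singleton hK (e := e) ?_
      ext x
      simp only [mem_inter_iff, mem_insert_iff, mem_singleton_iff]
      grind
    rcases (T \ {e, f}).eq_empty_or_nonempty with h1 | h1
    · have hsub := sdiff_eq_empty.1 h1
      by_cases hef' : e ∈ T ∧ f ∈ T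
      · have hind : M.Indep {e, f} := by
          have := (he.closure_eq_closure_iff_isCircuit_of_ne hef).not.2
            (hT2 e hef'.1 f hef'.2 hef)
          rw [he.closure_eq_closure_iff_eq_or_dep (hT f hef'.2)] at this
          simpa [hef] using this
        have h3 := ncard_le_rank hind
        rw [ncard_pair hef] at h3
        rw [h1, ncard_empty] at h2
        omega
      · have : T.ncard ≤ 1 := by
          rw [ncard_le_one hTfin]
          intro x hx y hy
          have := hsub hx
          have := hsub hy
          grind
        omega
    · have := ih inferInstance (T := T \ {e, f}) ?_ ?_ h1
      · omega
      · rintro x ⟨hx, hxef⟩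
        simp only [mem_insert_iff, mem_singleton_iff, not_or] at hxef
        rw [contract_isNonloop_iff]
        refine ⟨(hT x hx).mem_ground, fun hcl => ?_⟩
        have h3 := ((hT x hx).closure_eq_closure_iff_isCircuit_of_ne hxef.1).1
          ((hT x hx).closure_eq_of_mem_closure hcl)
        have h4 := hmem _ h3 (by simp)
        simp only [mem_insert_iff, mem_singleton_iff] at h4
        grind
      · rintro x ⟨hx, hxef⟩ y ⟨hy, hyef⟩ hxy hc
        obtain ⟨C, hC, h3, h4⟩ := hc.exists_subset_isCircuit_of_contract
        have heC : e ∉ C := fun heC => by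
          have := h4 (hmem C hC heC)
          simp only [mem_insert_iff, mem_singleton_iff, mem_union] at this hxef hyef
          grind
        refine hT2 x hx y hy hxy ?_
        have h5 : C = {x, y} := by
          refine subset_antisymm (fun z hz => ?_) ‹_›
          have := h4 hz
          simp only [mem_insert_iff, mem_singleton_iff, mem_union] at this ⊢
          grind
        rwa [← h5]

/-! ### Pointed matroids and the decomposition by parallel classes -/

/-- The quasi series-parallel matroids of rank `r` on all of `α` in which the base point `b` is a
loop. The base point collects all loops into one class of elements with equal closures. -/
def pointedQSP (b : α) (r : ℤ) : Set (Matroid α) :=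
  {M | M.E = univ ∧ M.IsLoop b ∧ (rank M : ℤ) = r ∧ IsSPReducible M}

/-- The pointed quasi series-parallel matroids in which distinct elements have distinct closures;
in other words the base point is the only loop, and there are no parallel elements. -/
def pointedSimpleQSP (b : α) (r : ℤ) : Set (Matroid α) :=
  {M | M ∈ pointedQSP b r ∧ Function.Injective fun x => M.closure {x}}

/-- The equivalence relation of having the same closure: its classes are the set of loops and
the parallel classes. -/
def closureSetoid (M : Matroid α) : Setoid α := Setoid.ker fun x => M.closure {x}

theorem closureSetoid_apply {x y : α} :
    closureSetoid M x y ↔ M.closure {x} = M.closure {y} := Iff.rfl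

theorem finite_matroid [Finite α] : Finite (Matroid α) := by
  refine Finite.of_injective (fun M : Matroid α => (M.E, {I | M.Indep I})) fun M N h => ?_
  simp only [Prod.mk.injEq] at h
  exact ext_indep h.1 fun I _ => (Set.ext_iff.1 h.2 I)

/-- Matroids with prescribed parallel classes correspond to simple matroids on the set of
classes. -/
theorem ncard_pointedQSP_fiber [Finite α] {g : α → β} (hg : Function.Surjective g) (b : α) (r : ℤ)
    {s : Setoid α} (hs : ∀ x y, g x = g y ↔ s x y) :
    {M | M ∈ pointedQSP b r ∧ closureSetoid M = s}.ncard = (pointedSimpleQSP (g b) r).ncard := by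
  have himg : (fun N : Matroid β => N.comap g) '' pointedSimpleQSP (g b) r =
      {M | M ∈ pointedQSP b r ∧ closureSetoid M = s} := by
    ext M
    constructor
    · rintro ⟨N, ⟨⟨hE, hb, hr, hN⟩, hinj⟩, rfl⟩
      refine ⟨⟨by simp [hE], comap_isLoop_iff.2 hb, ?_, (isSPReducible_comap_iff hE hg).2 hN⟩, ?_⟩
      · rwa [rank_comap (by simp [hg.range_eq])]
      · ext x y
        rw [closureSetoid_apply, closure_comap_singleton _ _ _ _ hg, ← hs]
        exact hinj.eq_iff
    · rintro ⟨⟨hE, hb, hr, hM⟩, hcl⟩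
      obtain ⟨t, ht⟩ := hg.hasRightInverse
      have hcl' : ∀ x y, M.closure {x} = M.closure {y} ↔ g x = g y := fun x y => by
        rw [hs, ← hcl, closureSetoid_apply]
      have hMM : (M.comap t).comap g = M := by
        rw [comap_comap]
        refine comap_eq_self (by simp [hE]) fun x => ?_
        rw [hcl']
        exact ht _
      have hE' : (M.comap t).E = univ := by simp [hE]
      refine ⟨M.comap t, ⟨⟨hE', ?_, ?_, ?_⟩, ?_⟩, hMM⟩
      · rw [← comap_isLoop_iff, hMM]
        exact hb
      · rw [← rank_comap (g := g) (by simp [hg.range_eq]), hMM]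
        exact hr
      · rw [← isSPReducible_comap_iff hE' hg, hMM]
        exact hM
      · intro x y hxy
        obtain ⟨x, rfl⟩ := hg x
        obtain ⟨y, rfl⟩ := hg y
        simp only at hxy
        rwa [← closure_comap_singleton _ _ _ _ hg, hMM, hcl'] at hxy
  rw [← himg, ncard_image_of_injective]
  intro N N' h
  obtain ⟨t, ht⟩ := hg.hasRightInverse
  have h1 : ∀ N : Matroid β, (N.comap g).comap t = N := fun N => by
    rw [comap_comap, ht.id, comap_id]
  rw [← h1 N, ← h1 N']
  exact congrArg (fun M : Matroid α => M.comap t) h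

/-- The number of equivalence classes other than that of the base point. -/
noncomputable def classCount {m : ℕ} (s : Setoid (Fin (m + 1))) : ℕ := Nat.card (Quotient s) - 1

theorem exists_quotient_map {m : ℕ} (s : Setoid (Fin (m + 1))) :
    ∃ g : Fin (m + 1) → Fin (classCount s + 1), Function.Surjective g ∧ g 0 = 0 ∧
      ∀ x y, g x = g y ↔ s x y := by
  have hpos : 0 < Nat.card (Quotient s) := Nat.card_pos
  have hcard : Nat.card (Quotient s) = Nat.card (Fin (classCount s + 1)) := by
    rw [Nat.card_fin, classCount]
    omega
  let φ := (Finite.card_eq.1 hcard).some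
  let ψ := φ.trans (Equiv.swap (φ (Quotient.mk s 0)) 0)
  refine ⟨fun x => ψ (Quotient.mk s x), ψ.surjective.comp Quotient.mk_surjective, ?_, ?_⟩
  · simp [ψ]
  · intro x y
    rw [ψ.injective.eq_iff, Quotient.eq]

theorem finite_setoid (n : ℕ) : Finite (Setoid (Fin n)) :=
  Finite.of_injective (fun s => fun x y => s x y) fun _ _ h =>
    Setoid.ext fun x y => iff_of_eq (congrFun (congrFun h x) y)

theorem ncard_pointedQSP (m : ℕ) (r : ℤ) :
    (pointedQSP (0 : Fin (m + 1)) r).ncard =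
      ∑ᶠ s : Setoid (Fin (m + 1)), (pointedSimpleQSP (0 : Fin (classCount s + 1)) r).ncard := by
  have := finite_matroid (α := Fin (m + 1))
  have := finite_setoid (m + 1)
  have := Fintype.ofFinite (Setoid (Fin (m + 1)))
  rw [finsum_eq_sum_of_fintype, ← Nat.card_coe_set_eq,
    ← Nat.card_congr (Equiv.sigmaFiberEquiv fun M : pointedQSP (0 : Fin (m + 1)) r =>
      closureSetoid M.1), Nat.card_sigma]
  refine Finset.sum_congr rfl fun s _ => ?_
  obtain ⟨g, hg, hg0, hs⟩ := exists_quotient_map s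
  have h1 := ncard_pointedQSP_fiber hg 0 r hs
  rw [hg0] at h1
  rw [← h1, ← Nat.card_coe_set_eq]
  exact Nat.card_congr (Equiv.subtypeSubtypeEquivSubtypeInter (· ∈ pointedQSP 0 r)
    (closureSetoid · = s))

/-! ### Removing the base point -/

theorem map_comap_succ {m : ℕ} {M : Matroid (Fin (m + 1))} :
    (M.comap Fin.succ).map Fin.succ (Fin.succ_injective m).injOn = M ＼ {0} := by
  refine ext_indep ?_ fun I _ => ?_
  · ext x
    refine Fin.cases ?_ (fun y => ?_) x
    · simp [Fin.succ_ne_zero]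
    · simp [Fin.succ_ne_zero]
  · rw [map_indep_iff, delete_indep_iff]
    constructor
    · rintro ⟨J, hJ, rfl⟩
      exact ⟨hJ.1, by simp [Fin.succ_ne_zero]⟩
    · rintro ⟨h1, h2⟩
      have : I ⊆ range (Fin.succ : Fin m → _) := by
        rw [Fin.range_succ]
        exact fun x hx h => disjoint_left.1 h2 hx h
      obtain ⟨J, rfl⟩ := subset_range_iff_exists_image_eq.1 this
      exact ⟨J, ⟨h1, (Fin.succ_injective m).injOn⟩, rfl⟩

theorem comap_succ_injOn {m : ℕ} {M N : Matroid (Fin (m + 1))} (hE : M.E = N.E)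
    (hM : M.IsLoop 0) (hN : N.IsLoop 0) (h : M.comap Fin.succ = N.comap Fin.succ) : M = N := by
  have h1 : M ＼ {0} = N ＼ {0} := by
    rw [← map_comap_succ, ← map_comap_succ]
    simp only [h]
  refine ext_indep hE fun I _ => ?_
  have h2 := congrArg (fun M => M.Indep I) h1
  simp only [delete_indep_iff, disjoint_singleton_right, eq_iff_iff] at h2
  exact ⟨fun h => (h2.1 ⟨h, hM.notMem_of_indep h⟩).1,
    fun h => (h2.2 ⟨h, hN.notMem_of_indep h⟩).1⟩

theorem isSPReducible_comap_succ {m : ℕ} {M : Matroid (Fin (m + 1))} (hM : M.IsLoop 0) :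
    IsSPReducible (M.comap Fin.succ) ↔ IsSPReducible M := by
  have : M.Finite := ⟨toFinite _⟩
  rw [← isSPReducible_map_iff (Fin.succ_injective m).injOn, map_comap_succ]
  exact ⟨.loop M 0 hM, fun h => h.delete_loop hM⟩

theorem rank_comap_succ {m : ℕ} {M : Matroid (Fin (m + 1))} (hE : M.E = univ) (hM : M.IsLoop 0) :
    rank (M.comap Fin.succ) = rank M := by
  rw [rank, rank, ← eRk_ground, ← eRk_ground, eRk_comap, comap_ground_eq, hE, preimage_univ,
    image_univ, ← eRk_closure_eq, ← closure_union_loops_eq, eRk_closure_eq]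
  congr 2
  rw [Fin.range_succ, eq_univ_iff_forall]
  intro x
  by_cases hx : x = 0
  · exact Or.inr (hx ▸ hM)
  · exact Or.inl hx

/-- Forgetting the base point. -/
theorem image_comap_succ_pointedQSP (m : ℕ) (r : ℤ) :
    (fun M : Matroid (Fin (m + 1)) => M.comap Fin.succ) '' pointedQSP 0 r = quasiSP m r := by
  ext M
  have : M.Finite := ⟨toFinite _⟩
  constructor
  · rintro ⟨M, ⟨hE, hM, hr, h⟩, rfl⟩
    have : (M.comap Fin.succ).Finite := ⟨toFinite _⟩
    refine ⟨by simp [hE], ?_, ?_⟩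
    · rwa [rank_comap_succ hE hM]
    · rwa [isQuasiSeriesParallel_iff, isSPReducible_comap_succ hM]
  · rintro ⟨hE, hr, h⟩
    rw [isQuasiSeriesParallel_iff] at h
    have hloop : (M.map Fin.succ (Fin.succ_injective m).injOn ↾ univ).IsLoop 0 := by
      rw [restrict_isLoop_iff]
      exact ⟨mem_univ _, Or.inr (by simp [Fin.succ_ne_zero])⟩
    have hcomap : (M.map Fin.succ (Fin.succ_injective m).injOn ↾ univ).comap Fin.succ = M := by
      refine ext_indep (by simp [hE]) fun I _ => ?_
      rw [comap_indep_iff, restrict_indep_iff, map_image_indep_iff (by simp [hE])]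
      exact ⟨fun h => h.1.1, fun h => ⟨⟨h, subset_univ _⟩, (Fin.succ_injective m).injOn⟩⟩
    refine ⟨_, ⟨restrict_ground_eq, hloop, ?_, ?_⟩, hcomap⟩
    · rwa [← rank_comap_succ restrict_ground_eq hloop, hcomap]
    · rwa [← isSPReducible_comap_succ hloop, hcomap]

theorem isSimple_comap_succ_iff {m : ℕ} {M : Matroid (Fin (m + 1))} (hE : M.E = univ)
    (hM : M.IsLoop 0) :
    IsSimple (M.comap Fin.succ) ↔ Function.Injective fun x => M.closure {x} := by
  have hcirc : ∀ {x y : Fin m}, x ≠ y → (M.comap Fin.succ).IsNonloop x →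
      ((M.comap Fin.succ).IsCircuit {x, y} ↔ M.closure {x.succ} = M.closure {y.succ}) := by
    intro x y hxy hx
    have hx' : M.IsNonloop x.succ := comap_isNonloop_iff.1 hx
    have hxy' : x.succ ≠ y.succ := (Fin.succ_injective m).ne hxy
    rw [hx'.closure_eq_closure_iff_isCircuit_of_ne hxy', ← image_pair]
    have hinj : ∀ D : Set (Fin m), InjOn Fin.succ D := fun D => (Fin.succ_injective m).injOn
    have h1 : ∀ {D : Set (Fin m)}, (M.comap Fin.succ).Dep D ↔ M.Dep (Fin.succ '' D) := by
      intro D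
      simp only [Dep, comap_indep_iff, comap_ground_eq, hE, preimage_univ, subset_univ, and_true,
        hinj D]
    rw [isCircuit_iff, isCircuit_iff, h1]
    refine and_congr_right fun _ => ⟨fun h D hD hDs => ?_, fun h D hD hDs => ?_⟩
    · obtain ⟨D', hD', rfl⟩ := subset_image_iff.1 hDs
      rw [h (h1.2 hD) hD']
    · exact (Fin.succ_injective m).image_injective (h (h1.1 hD) (image_mono hDs))
  constructor
  · rintro ⟨hl, hc⟩
    have hnl : ∀ x : Fin m, (M.comap Fin.succ).IsNonloop x := fun x =>
      loopless_iff_forall_isNonloop.1 hl _ (by simp [hE])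
    have h0 : ∀ x : Fin m, M.closure {x.succ} ≠ M.closure {0} := fun x h => by
      rw [hM.closure] at h
      exact (comap_isNonloop_iff.1 (hnl x)).not_isLoop
        ((isLoop_iff_closure_eq_loops (by simp [hE])).2 h)
    intro x y
    refine Fin.cases (Fin.cases (fun _ => rfl) (fun y h => absurd h.symm (h0 y)) y) (fun x => ?_) x
    refine Fin.cases (fun h => absurd h (h0 x)) (fun y h => ?_) y
    by_contra hne
    have hxy : x ≠ y := fun h => hne (congrArg _ h)
    exact hc _ ((hcirc hxy (hnl x)).2 h) (encard_pair hxy)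
  · intro hinj
    have hl : (M.comap Fin.succ).Loopless := by
      rw [loopless_iff_forall_not_isLoop]
      intro x _ hx
      rw [comap_isLoop_iff] at hx
      have : M.closure {x.succ} = M.closure {0} := by rw [hx.closure, hM.closure]
      exact Fin.succ_ne_zero x (hinj this)
    refine ⟨hl, fun C hC hC2 => ?_⟩
    obtain ⟨x, y, hxy, rfl⟩ := encard_eq_two.1 hC2
    rw [hcirc hxy (loopless_iff_forall_isNonloop.1 hl _ (by simp [hE]))] at hC
    exact hxy (Fin.succ_injective m (hinj hC))

theorem ncard_quasiSP_eq_pointed (m : ℕ) (r : ℤ) :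
    (quasiSP m r).ncard = (pointedQSP (0 : Fin (m + 1)) r).ncard := by
  rw [← image_comap_succ_pointedQSP, InjOn.ncard_image]
  intro M hM N hN h
  exact comap_succ_injOn (hM.1.trans hN.1.symm) hM.2.1 hN.2.1 h

theorem ncard_simpleQuasiSP_eq_pointed (m : ℕ) (r : ℤ) :
    (simpleQuasiSP m r).ncard = (pointedSimpleQSP (0 : Fin (m + 1)) r).ncard := by
  have h : simpleQuasiSP m r =
      (fun M : Matroid (Fin (m + 1)) => M.comap Fin.succ) '' pointedSimpleQSP 0 r := by
    ext M
    rw [simpleQuasiSP, mem_ofPred_eq, ← image_comap_succ_pointedQSP]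
    constructor
    · rintro ⟨⟨M, hM, rfl⟩, h⟩
      exact ⟨M, ⟨hM, (isSimple_comap_succ_iff hM.1 hM.2.1).1 h⟩, rfl⟩
    · rintro ⟨M, ⟨hM, h⟩, rfl⟩
      exact ⟨⟨M, hM, rfl⟩, (isSimple_comap_succ_iff hM.1 hM.2.1).2 h⟩
  rw [h, InjOn.ncard_image]
  intro M hM N hN h
  exact comap_succ_injOn (hM.1.1.trans hN.1.1.symm) hM.1.2.1 hN.1.2.1 h

/-- A quasi series-parallel matroid amounts to the partition of its elements into the set of loops
and the parallel classes, and to a simple quasi series-parallel matroid on the set of parallel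
classes. -/
theorem ncard_quasiSP_eq_finsum (m : ℕ) (r : ℤ) :
    (quasiSP m r).ncard =
      ∑ᶠ s : Setoid (Fin (m + 1)), (simpleQuasiSP (classCount s) r).ncard := by
  rw [ncard_quasiSP_eq_pointed, ncard_pointedQSP]
  exact finsum_congr fun s => (ncard_simpleQuasiSP_eq_pointed _ _).symm

/-! ### Symmetry and vanishing of the numbers of quasi series-parallel matroids -/

/-- Duality exchanges rank and corank. -/
theorem ncard_quasiSP_symm (m : ℕ) (r : ℤ) : (quasiSP m r).ncard = (quasiSP m (m - r)).ncard := by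
  have hsub : ∀ r : ℤ, Matroid.dual '' quasiSP m r ⊆ quasiSP m (m - r) := by
    rintro r _ ⟨M, ⟨hE, hr, h⟩, rfl⟩
    have : M.Finite := ⟨toFinite _⟩
    have h1 := rank_dual_add (M := M)
    rw [hE, ncard_univ, Nat.card_fin] at h1
    exact ⟨hE, by omega, h.dual⟩
  have himg : Matroid.dual '' quasiSP m r = quasiSP m (m - r) := by
    refine (hsub r).antisymm fun M hM => ⟨M✶, ?_, dual_dual M⟩
    have := hsub _ ⟨M, hM, rfl⟩
    rwa [sub_sub_cancel] at this
  rw [← himg, ncard_image_of_injective _ dual_injective]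

/-- The counterpart of the degree bound for Kazhdan–Lusztig polynomials. -/
theorem simpleQuasiSP_eq_empty {m : ℕ} (hm : 0 < m) {r : ℤ} (hr : 2 * r ≤ m) :
    simpleQuasiSP m r = ∅ := by
  refine eq_empty_of_forall_notMem ?_
  rintro M ⟨⟨hE, hr', h⟩, hl, hc⟩
  have : M.Finite := ⟨toFinite _⟩
  have : NeZero m := ⟨hm.ne'⟩
  have h1 := (isQuasiSeriesParallel_iff.1 h).ncard_lt inferInstance (T := univ)
    (fun x _ => loopless_iff_forall_isNonloop.1 hl _ (by simp [hE]))
    (fun x _ y _ hxy hC => hc _ hC (encard_pair hxy))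
    ⟨0, mem_univ _⟩
  rw [ncard_univ, Nat.card_fin] at h1
  omega

theorem quasiSP_eq_empty {m : ℕ} {r : ℤ} (hr : (m : ℤ) < r) : quasiSP m r = ∅ := by
  refine eq_empty_of_forall_notMem ?_
  rintro M ⟨hE, hr', -⟩
  have : M.Finite := ⟨toFinite _⟩
  have h1 := rank_le_ncard (M := M)
  rw [hE, ncard_univ, Nat.card_fin] at h1
  omega

theorem simpleQuasiSP_eq_empty_of_lt {m : ℕ} {r : ℤ} (hr : (m : ℤ) < r) :
    simpleQuasiSP m r = ∅ :=
  subset_empty_iff.1 fun _ hM => (quasiSP_eq_empty hr).subset hM.1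

theorem ncard_simpleQuasiSP_zero (r : ℤ) : (simpleQuasiSP 0 r).ncard = if r = 0 then 1 else 0 := by
  have hM : ∀ M : Matroid (Fin 0), M = emptyOn (Fin 0) := fun M => by
    rw [← ground_eq_empty_iff]
    exact eq_empty_of_isEmpty _
  have hr0 : rank (emptyOn (Fin 0)) = 0 := by simp [rank]
  split_ifs with hr
  · rw [ncard_eq_one]
    refine ⟨emptyOn (Fin 0),
      eq_singleton_iff_unique_mem.2 ⟨⟨⟨?_, ?_, ?_⟩, ?_, ?_⟩, fun M _ => hM M⟩⟩
    · exact Subsingleton.elim _ _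
    · simp [hr0, hr]
    · exact (IsSPReducible.empty _ rfl).isQuasiSeriesParallel
    · rw [loopless_iff_forall_not_isLoop]
      exact fun x => x.elim0
    · intro C hC
      obtain ⟨x, -⟩ := hC.nonempty
      exact x.elim0
  · have hempty : simpleQuasiSP 0 r = ∅ := by
      refine eq_empty_of_forall_notMem ?_
      rintro M ⟨⟨-, h, -⟩, -⟩
      rw [hM M, hr0] at h
      exact hr h.symm
    rw [hempty, ncard_empty]

open Polynomial

/-! ### Kazhdan–Lusztig polynomials of pullbacks -/

theorem isKLFamily_klPoly : IsKLFamily (klPoly (α := α)) :=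
  (existsUnique_isKLFamily α).choose_spec.1

theorem klPoly_eq (M : LooplessMatroid α) :
    klPoly M = if rank M.1 = 0 then 1 else complement (rank M.1) (zTail klPoly M) := by
  rw [isKLFamily_klPoly.unique isKLFamily_klRec]
  exact klRec_eq M

theorem isFlat_preimage {N : Matroid β} {g : α → β} (hg : N.E ⊆ range g) {G : Set β}
    (hG : N.IsFlat G) : (N.comap g).IsFlat (g ⁻¹' G) := by
  rw [isFlat_iff_closure_eq, comap_closure_eq,
    image_preimage_eq_of_subset (hG.subset_ground.trans hg), hG.closure]

theorem exists_isFlat_preimage_eq {N : Matroid β} {g : α → β} {F : Set α}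
    (hF : (N.comap g).IsFlat F) : ∃ G, N.IsFlat G ∧ g ⁻¹' G = F :=
  ⟨N.closure (g '' F), isFlat_closure _, by rw [← comap_closure_eq, hF.closure]⟩

/-- Adding parallel elements and renaming elements does not change the Kazhdan–Lusztig
polynomial. -/
theorem klPoly_comap {N : LooplessMatroid β} {M : LooplessMatroid α} {g : α → β}
    (hg : N.1.E ⊆ range g) (hM : M.1 = N.1.comap g) : klPoly M = klPoly N := by
  suffices H : ∀ n, ∀ (N : LooplessMatroid β) (M : LooplessMatroid α), N.1.E.ncard = n →
      N.1.E ⊆ range g → M.1 = N.1.comap g → klPoly M = klPoly N from H _ N M rfl hg hM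
  intro n
  induction n using Nat.strong_induction_on with
  | _ n ih =>
  intro N M hn hg hM
  have hsub : ∀ {G}, N.1.IsFlat G → G ⊆ range g := fun hG => hG.subset_ground.trans hg
  have htail : zTail klPoly M = zTail klPoly N := by
    symm
    refine finsum_eq_of_bijective
      (fun G => ⟨⟨g ⁻¹' G.1.1, hM ▸ isFlat_preimage hg G.1.2⟩, ?_⟩) ⟨?_, ?_⟩ fun G => ?_
    · obtain ⟨y, hy⟩ := G.2
      obtain ⟨x, rfl⟩ := hsub G.1.2 hy
      exact ⟨x, hy⟩
    · intro G G' h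
      simp only [Subtype.mk.injEq] at h
      refine Subtype.ext (Subtype.ext ?_)
      rw [← image_preimage_eq_of_subset (hsub G.1.2), h,
        image_preimage_eq_of_subset (hsub G'.1.2)]
    · rintro ⟨⟨F, hF⟩, hne⟩
      obtain ⟨G, hG, rfl⟩ := exists_isFlat_preimage_eq (hM ▸ hF)
      obtain ⟨x, hx⟩ := hne
      exact ⟨⟨⟨G, hG⟩, ⟨g x, hx⟩⟩, rfl⟩
    · congr 1
      · congr 1
        change rk N.1 G.1.1 = rk M.1 (g ⁻¹' G.1.1)
        rw [rk, rk, hM, eRk_comap, image_preimage_eq_of_subset (hsub G.1.2)]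
      · refine (ih _ (hn ▸ ncard_contract_lt G.2) _ _ rfl (sdiff_subset.trans hg) ?_).symm
        change M.1 ／ (g ⁻¹' G.1.1) = _
        rw [hM]
        exact (comap_contract N.1 g (hsub G.1.2)).symm
  rw [klPoly_eq M, klPoly_eq N, htail, hM, rank_comap hg]

open SimpleGraph

variable {V W : Type*}

/-! ### Flats of braid matroids -/

theorem reachable_iff_forall_setoid {X : Set (Sym2 V)} {u v : V} :
    (fromEdgeSet X).Reachable u v ↔
      ∀ r : Setoid V, (∀ a b, s(a, b) ∈ X → r a b) → r u v := by
  constructor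
  · rintro ⟨p⟩ r hr
    induction p with
    | nil => exact r.refl _
    | cons h _ ih => exact r.trans (hr _ _ ((fromEdgeSet_adj X).1 h).1) ih
  · intro h
    refine h (fromEdgeSet X).reachableSetoid fun a b hab => ?_
    by_cases hne : a = b
    · exact hne ▸ Reachable.refl a
    · exact Adj.reachable ((fromEdgeSet_adj X).2 ⟨hab, hne⟩)

theorem mem_closure_cycleMatroid {G : SimpleGraph V} {X : Set (Sym2 V)} (hX : X ⊆ G.edgeSet)
    {u v : V} : s(u, v) ∈ (cycleMatroid G).closure X ↔
      G.Adj u v ∧ (fromEdgeSet X).Reachable u v := by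
  obtain ⟨I, hI⟩ := (cycleMatroid G).exists_isBasis X hX
  have hind : ∀ u v, s(u, v) ∈ (cycleMatroid G).closure I ↔
      G.Adj u v ∧ (fromEdgeSet I).Reachable u v := by
    intro u v
    have hIi : I ⊆ G.edgeSet ∧ (fromEdgeSet I).IsAcyclic := hI.indep
    rw [hI.indep.mem_closure_iff']
    change s(u, v) ∈ G.edgeSet ∧ ((insert s(u, v) I ⊆ G.edgeSet ∧
      (fromEdgeSet (insert s(u, v) I)).IsAcyclic) → s(u, v) ∈ I) ↔ _
    rw [mem_edgeSet]
    refine and_congr_right fun huv => ?_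
    have hsub : insert s(u, v) I ⊆ G.edgeSet := insert_subset huv hIi.1
    rw [and_iff_right hsub, ← union_singleton, fromEdgeSet_union,
      ← edge, isAcyclic_sup_fromEdgeSet_iff, and_iff_right hIi.2, fromEdgeSet_adj]
    constructor
    · intro h
      by_contra hr
      exact hr (Adj.reachable ((fromEdgeSet_adj I).2 ⟨h fun h' => absurd h' hr, huv.ne⟩))
    · intro hr h
      exact ((h hr).resolve_left huv.ne).1
  rw [← hI.closure_eq_closure, hind]
  refine and_congr_right fun _ => ⟨fun h => h.mono (fromEdgeSet_mono hI.subset), fun h => ?_⟩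
  rw [reachable_iff_forall_setoid] at h
  refine h (fromEdgeSet I).reachableSetoid fun a b hab => ?_
  exact ((hind a b).1 (hI.subset_closure hab)).2

/-- The closure operator of the cycle matroid of a complete graph in terms of equivalence
relations. -/
theorem mem_closure_cycleMatroid_top {X : Set (Sym2 V)} {u v : V} :
    s(u, v) ∈ (cycleMatroid (⊤ : SimpleGraph V)).closure X ↔
      u ≠ v ∧ ∀ r : Setoid V, (∀ a b, s(a, b) ∈ X → r a b) → r u v := by
  rw [← closure_inter_ground]
  change s(u, v) ∈ (cycleMatroid ⊤).closure (X ∩ edgeSet ⊤) ↔ _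
  rw [mem_closure_cycleMatroid inter_subset_right,
    reachable_iff_forall_setoid, top_adj]
  refine and_congr_right fun _ => forall_congr' fun r => imp_congr_left ?_
  refine forall₂_congr fun a b => ⟨fun h hab => ?_, fun h hab => h hab.1⟩
  by_cases hne : a = b
  · exact hne ▸ r.refl a
  · exact h ⟨hab, hne⟩

/-- The flat of the cycle matroid of the complete graph on `V` that belongs to an equivalence
relation: the set of the edges between equivalent vertices. -/
def equivFlat (r : Setoid V) : Set (Sym2 V) := {e | ¬ e.IsDiag ∧ ∀ u v, e = s(u, v) → r u v}

theorem mem_equivFlat {r : Setoid V} {u v : V} : s(u, v) ∈ equivFlat r ↔ u ≠ v ∧ r u v := by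
  simp only [equivFlat, mem_ofPred_eq, Sym2.mk_isDiag_iff]
  refine and_congr_right fun _ => ⟨fun h => h u v rfl, fun h a b hab => ?_⟩
  rcases Sym2.eq_iff.1 hab with ⟨rfl, rfl⟩ | ⟨rfl, rfl⟩
  · exact h
  · exact r.symm h

theorem isFlat_equivFlat (r : Setoid V) :
    (cycleMatroid (⊤ : SimpleGraph V)).IsFlat (equivFlat r) := by
  rw [isFlat_iff_closure_eq]
  ext e
  induction e with
  | _ u v =>
  rw [mem_closure_cycleMatroid_top, mem_equivFlat]
  refine and_congr_right fun hne => ⟨fun h => h r fun a b hab => (mem_equivFlat.1 hab).2,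
    fun h r' hr' => hr' u v (mem_equivFlat.2 ⟨hne, h⟩)⟩

theorem equivFlat_bijective : Function.Bijective fun r : Setoid V =>
    (⟨equivFlat r, isFlat_equivFlat r⟩ :
      {F // (cycleMatroid (⊤ : SimpleGraph V)).IsFlat F}) := by
  constructor
  · intro r r' h
    simp only [Subtype.mk.injEq] at h
    ext u v
    by_cases huv : u = v
    · subst huv
      exact iff_of_true (r.refl u) (r'.refl u)
    · have h1 := mem_equivFlat (r := r) (u := u) (v := v)
      rw [h, mem_equivFlat] at h1
      simpa [huv] using h1.symm
  · rintro ⟨F, hF⟩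
    refine ⟨sInf {r | ∀ a b, s(a, b) ∈ F → r a b}, Subtype.ext ?_⟩
    ext e
    induction e with
    | _ u v =>
    have h := mem_closure_cycleMatroid_top (X := F) (u := u) (v := v)
    rw [hF.closure] at h
    exact mem_equivFlat.trans h.symm

/-- Contracting the flat of an equivalence relation gives the braid matroid on the classes, with
parallel elements. -/
theorem contract_equivFlat {q : V → W} (hq : Function.Surjective q) {s : Setoid V}
    (hs : ∀ x y, q x = q y ↔ s x y) : cycleMatroid (⊤ : SimpleGraph V) ／ equivFlat s =
      (cycleMatroid (⊤ : SimpleGraph W)).comap (Sym2.map q) := by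
  refine ext_closure fun X => ?_
  ext e
  induction e with
  | _ u v =>
  rw [contract_closure_eq, comap_closure_eq, mem_sdiff, mem_preimage, Sym2.map_mk,
    mem_closure_cycleMatroid_top, mem_closure_cycleMatroid_top, mem_equivFlat]
  constructor
  · rintro ⟨⟨hne, h⟩, h'⟩
    refine ⟨fun hquv => h' ⟨hne, (hs u v).1 hquv⟩, fun r' hr' => ?_⟩
    refine h (r'.comap q) fun a b hab => ?_
    rcases hab with hab | hab
    · exact hr' _ _ ⟨_, hab, by simp⟩
    · have : q a = q b := (hs a b).2 (mem_equivFlat.1 hab).2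
      change r' (q a) (q b)
      rw [this]
  · rintro ⟨hquv, h⟩
    refine ⟨⟨fun huv => hquv (huv ▸ rfl), fun r hr => ?_⟩, fun h' => hquv ((hs u v).2 h'.2)⟩
    obtain ⟨t, ht⟩ := hq.hasRightInverse
    have hsr : ∀ x, r (t (q x)) x := fun x => by
      by_cases hx : t (q x) = x
      · rw [hx]
      · exact hr _ _ (Or.inr (mem_equivFlat.2 ⟨hx, (hs _ _).1 (ht _)⟩))
    have h1 : r (t (q u)) (t (q v)) := by
      refine h (r.comap t) fun a b hab => ?_
      obtain ⟨e, he, hab⟩ := hab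
      induction e with
      | _ x y =>
      rw [Sym2.map_mk, Sym2.eq_iff] at hab
      have hxy : r x y := hr x y (Or.inl he)
      have h2 : r (t (q x)) (t (q y)) := r.trans (hsr x) (r.trans hxy (r.symm (hsr y)))
      rcases hab with ⟨rfl, rfl⟩ | ⟨rfl, rfl⟩
      · exact h2
      · exact r.symm h2
    exact r.trans (r.symm (hsr u)) (r.trans h1 (hsr v))

theorem rank_cycleMatroid_top [Finite V] [Nonempty V] :
    rank (cycleMatroid (⊤ : SimpleGraph V)) + 1 = Nat.card V := by
  classical
  have := Fintype.ofFinite V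
  obtain ⟨B, hB⟩ := (cycleMatroid (⊤ : SimpleGraph V)).exists_isBase
  have hBi : B ⊆ (⊤ : SimpleGraph V).edgeSet ∧ (fromEdgeSet B).IsAcyclic := hB.indep
  have hconn : (fromEdgeSet B).Connected := by
    refine ⟨fun u v => ?_⟩
    by_cases huv : u = v
    · exact huv ▸ Reachable.refl u
    · refine ((mem_closure_cycleMatroid hBi.1).1 ?_).2
      rw [hB.closure_eq]
      exact huv
  have hE := edgeSet_fromEdgeSet_of_subset hBi.1
  have := (IsTree.mk hconn hBi.2).card_edgeFinset
  rw [rank_eq_ncard hB, Nat.card_eq_fintype_card, ← this, edgeFinset, ← ncard_eq_toFinset_card', hE]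

theorem range_sym2_map {q : V → W} (hq : Function.Surjective q) :
    range (Sym2.map q) = univ := by
  refine eq_univ_of_forall fun e => ?_
  induction e with
  | _ a b =>
  obtain ⟨a, rfl⟩ := hq a
  obtain ⟨b, rfl⟩ := hq b
  exact ⟨s(a, b), rfl⟩

theorem rank_braidMatroid (m : ℕ) : rank (braidMatroid (m + 1)).1 = m := by
  have := rank_cycleMatroid_top (V := Fin (m + 1))
  rw [Nat.card_fin] at this
  exact Nat.succ_injective this

theorem classCount_add_rk {m : ℕ} (s : Setoid (Fin (m + 1))) :
    classCount s + rk (braidMatroid (m + 1)).1 (equivFlat s) = m := by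
  obtain ⟨q, hq, -, hs⟩ := exists_quotient_map s
  have h := rank_contract (braidMatroid (m + 1)).2.1 (isFlat_equivFlat s)
  rw [rank_braidMatroid, braidMatroid, contract_equivFlat hq hs, rank_comap] at h
  · rwa [show rank (cycleMatroid _) = _ from rank_braidMatroid (classCount s)] at h
  · exact (range_sym2_map hq).symm ▸ subset_univ _

/-- The `Z`-polynomial of a braid matroid in terms of Kazhdan–Lusztig polynomials of smaller braid
matroids. -/
theorem zPoly_braidMatroid (m : ℕ) : zPoly (braidMatroid (m + 1)) =
    ∑ᶠ s : Setoid (Fin (m + 1)),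
      X ^ (m - classCount s) * klPoly (braidMatroid (classCount s + 1)) := by
  symm
  refine finsum_eq_of_bijective _ equivFlat_bijective fun s => ?_
  obtain ⟨q, hq, -, hs⟩ := exists_quotient_map s
  congr 1
  · congr 1
    have := classCount_add_rk s
    change _ = rk (braidMatroid (m + 1)).1 (equivFlat s)
    omega
  · refine (klPoly_comap (g := Sym2.map q) ?_ (contract_equivFlat hq hs)).symm
    exact (range_sym2_map hq).symm ▸ subset_univ _

/-! ### Comparison of coefficients -/

theorem classCount_le {m : ℕ} (s : Setoid (Fin (m + 1))) : classCount s ≤ m :=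
  (classCount_add_rk s).le.trans' (Nat.le_add_right _ _)

theorem classCount_eq_iff {m : ℕ} {s : Setoid (Fin (m + 1))} : classCount s = m ↔ s = ⊥ := by
  obtain ⟨q, hq, -, hs⟩ := exists_quotient_map s
  constructor
  · intro h
    have hinj : Function.Injective q :=
      (hq.bijective_of_nat_card_le (by simp [h])).injective
    ext x y
    rw [← hs, hinj.eq_iff]
    rfl
  · rintro rfl
    have hinj : Function.Injective q := fun x y h => (hs x y).1 h
    have := Nat.card_le_card_of_injective q hinj
    simp only [Nat.card_fin] at this
    have := classCount_le (⊥ : Setoid (Fin (m + 1)))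
    omega

/-- In the recursions for the `Z`-polynomial and for the number of quasi series-parallel matroids,
the terms that belong to proper quotients agree if the theorem is known for smaller braid
matroids. -/
theorem coeff_zPoly_sub {m : ℕ} (ih : ∀ k < m, ∀ i, (klPoly (braidMatroid (k + 1))).coeff i =
      ((simpleQuasiSP k (k - i)).ncard : ℤ)) (i : ℕ) :
    (zPoly (braidMatroid (m + 1))).coeff i - ((quasiSP m (m - i)).ncard : ℤ) =
      (klPoly (braidMatroid (m + 1))).coeff i - ((simpleQuasiSP m (m - i)).ncard : ℤ) := by
  have := finite_setoid (m + 1)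
  have := Fintype.ofFinite (Setoid (Fin (m + 1)))
  rw [zPoly_braidMatroid, ncard_quasiSP_eq_finsum, finsum_eq_sum_of_fintype,
    finsum_eq_sum_of_fintype, finsetSum_coeff, Nat.cast_sum, ← Finset.sum_sub_distrib,
    Finset.sum_eq_single ⊥]
  · rw [classCount_eq_iff.2 rfl, Nat.sub_self, pow_zero, one_mul]
  · intro s _ hs
    have hle := classCount_le s
    have hlt : classCount s < m := lt_of_le_of_ne hle fun h => hs (classCount_eq_iff.1 h)
    rw [coeff_X_pow_mul', sub_eq_zero]
    split_ifs with hi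
    · rw [ih _ hlt]
      congr 3
      omega
    · rw [simpleQuasiSP_eq_empty_of_lt (by omega), ncard_empty, Nat.cast_zero]
  · exact fun h => absurd (Finset.mem_univ _) h

theorem coeff_zPoly_symm {m i : ℕ} (hi : i ≤ m) : (zPoly (braidMatroid (m + 1))).coeff (m - i) =
    (zPoly (braidMatroid (m + 1))).coeff i := by
  obtain ⟨h1, h2⟩ := isKLFamily_klPoly.palindromic (braidMatroid (m + 1))
  rw [rank_braidMatroid] at h2
  have h3 := congrArg (fun f => f.coeff i) h1
  simp only [coeff_reverse, h2, revAt_le hi] at h3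
  exact h3

theorem coeff_klPoly_eq_zero {m i : ℕ} (hm : 0 < m) (hi : m ≤ 2 * i) :
    (klPoly (braidMatroid (m + 1))).coeff i = 0 := by
  have h := isKLFamily_klPoly.degree_lt (braidMatroid (m + 1))
  rw [rank_braidMatroid] at h
  exact coeff_eq_zero_of_natDegree_lt (by have := h hm; omega)

theorem coeff_klPoly_braidMatroid (m : ℕ) : ∀ i, (klPoly (braidMatroid (m + 1))).coeff i =
    ((simpleQuasiSP m (m - i)).ncard : ℤ) := by
  induction m using Nat.strong_induction_on with
  | _ m ih =>
  intro i
  rcases Nat.eq_zero_or_pos m with rfl | hm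
  · rw [isKLFamily_klPoly.rank_zero _ (rank_braidMatroid 0), ncard_simpleQuasiSP_zero, coeff_one]
    simp
  rcases le_or_gt m (2 * i) with hi | hi
  · rw [coeff_klPoly_eq_zero hm hi, simpleQuasiSP_eq_empty hm (by omega), ncard_empty,
      Nat.cast_zero]
  -- in degree `m - i` both degree bounds apply, so that the recursions determine the
  -- coefficients of the `Z`-polynomial there; these are carried over to degree `i` by symmetry
  have h1 := coeff_zPoly_sub ih i
  have h2 := coeff_zPoly_sub ih (m - i)
  rw [coeff_klPoly_eq_zero hm (by omega), simpleQuasiSP_eq_empty hm (by omega), ncard_empty,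
    coeff_zPoly_symm (by omega), ncard_quasiSP_symm,
    show (m : ℤ) - (m - ((m - i : ℕ) : ℤ)) = m - i by omega, Nat.cast_zero] at h2
  linarith

theorem coeff_zPoly_braidMatroid (m i : ℕ) : (zPoly (braidMatroid (m + 1))).coeff i =
    ((quasiSP m (m - i)).ncard : ℤ) := by
  have := coeff_zPoly_sub (fun k _ => coeff_klPoly_braidMatroid k) i (m := m)
  rw [coeff_klPoly_braidMatroid] at this
  linarith

end BraidKL

/-- The coefficients of the Kazhdan–Lusztig polynomial and of the `Z`-polynomial of the braid
matroid `K_n` count (simple) quasi series-parallel matroids on `[n - 1]`. -/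
theorem theorem1p1 (n : ℕ) (hn : 1 ≤ n) (i : ℕ) :
    (BraidKL.klPoly (BraidKL.braidMatroid n)).coeff i =
        ((BraidKL.simpleQuasiSP (n - 1) ((n : ℤ) - 1 - (i : ℤ))).ncard : ℤ) ∧
      (BraidKL.zPoly (BraidKL.braidMatroid n)).coeff i =
        ((BraidKL.quasiSP (n - 1) ((n : ℤ) - 1 - (i : ℤ))).ncard : ℤ) := by
  obtain ⟨m, rfl⟩ := Nat.exists_eq_add_of_le' hn
  rw [Nat.add_sub_cancel, show ((m + 1 : ℕ) : ℤ) - 1 - i = m - i by push_cast; ring]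
  exact ⟨BraidKL.coeff_klPoly_braidMatroid m i, BraidKL.coeff_zPoly_braidMatroid m i⟩
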